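/- **Setting.** Let $R,C\ge 1$ and let $p=(p_{ij})_{1\le i\le R,\,1\le j\le C}$ have positive entries. Consider a sequence of finite populations $U_N$ of $N$ units, where unit $k$ has a cell $y_k\in\{1,\dots,R\}\times\{1,\dots,C\}$ and an inclusion probability $\pi_k$ (possibly random and dependent on $y_k$). The cells are generated so that $N^{-1}\sum_{k}\Pr\{y_k=(i,j)\}\to p_{ij}$ for all $i,j$ (for instance $y_1,\dots,y_N$ i.i.d. with cell probabilities $p_{ij}$, or a fixed population with $N_{ij}/N\to p_{ij}$). A sample $A\subseteq U_N$ is drawn by Poisson sampling: with $I_k=\mathbf 1\{k\in A\}$, the triples $(y_k,\pi_k,I_k)$ are independent over $k$ and $\Pr(I_k=1\mid y_k,\pi_k)=\pi_k$. Put $n_0=E\sum_k\pi_k$, the expected sample size, and $w_k=\pi_k^{-1}$. Assume that * $n_0\to\infty$, $n_0/N\to0$, and there are constants $C_1,C_2>0$ with $C_1\le N n_0^{-1}\pi_k\le C_2$ almost surely for all $k$ and $N$; * the asymptotic covariance matrix $\Sigma_p$ of the free cell proportions (all cells but $(R,C)$) exists: for all cells $a,b\neq(R,C)$, $$n_0\,\mathrm{cov}\Big(\tfrac1N\sum_{k\in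 A}w_k(\mathbf 1\{y_k=a\}-p_a),\ \tfrac1N\sum_{k\in A}w_k(\mathbf 1\{y_k=b\}-p_b)\Big)\to(\Sigma_p)_{ab}.$$ **Bootstrap.** Let $n=|A|$ and $\hat p_{ij}=\sum_{k\in A,\,y_k=(i,j)}w_k\big/\sum_{k\in A}w_k$. Given the sample, let $(N_k^*)_{k\in A}$ be multinomial with $N$ trials and probabilities proportional to $w_k$; given these, let $m_k^*\sim\mathrm{Bin}(N_k^*,\pi_k)$ independently for $k\in A$. Let $w_k^*=w_km_k^*$, and let $\hat p^*_{ij}$ be $\hat p_{ij}$ with $w_k$ replaced by $w_k^*$. With $+$ denoting summation over an index and $\hat\Delta_{ij}=\hat p_{ij}/(\hat p_{i+}\hat p_{+j})$, put $$X_I^{2*}=n\sum_{i=1}^R\sum_{j=1}^C\frac{\{(\hat p^*_{ij}-\hat p^*_{i+}\hat p^*_{+j})-(\hat p_{ij}-\hat p_{i+}\hat p_{+j})\}^2}{\hat p_{i+}\hat p_{+j}},$$ $$W_I^*=2n\sum_{i=1}^R\sum_{j=1}^C\Big[\hat p^*_{ij}\log\Big\{\frac{\hat p^*_{ij}}{\hat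 p^*_{i+}\hat p^*_{+j}\hat\Delta_{ij}}\Big\}-(\hat p^*_{ij}-\hat p^*_{i+}\hat p^*_{+j}\hat\Delta_{ij})\Big].$$ **Limit.** Let $h_{ij}(p)=p_{ij}-p_{i+}p_{+j}$ for $i\le R-1$, $j\le C-1$, regarded as a function of the $RC-1$ free cells (the proportion of cell $(R,C)$ is one minus the sum of the others), and $H=\partial h(p)/\partial p^{T}$. Let $p_{R+}=(p_{1+},\dots,p_{R-1,+})^T$, $p_{+C}=(p_{+1},\dots,p_{+,C-1})^T$, $P_{R+}=\mathrm{diag}(p_{R+})-p_{R+}p_{R+}^T$ and $P_{+C}=\mathrm{diag}(p_{+C})-p_{+C}p_{+C}^T$. Let $d=(R-1)(C-1)$. **Theorem.** The design effect matrix $D_h=(P_{R+}^{-1}\otimes P_{+C}^{-1})(H\Sigma_pH^T)$ has $d$ real eigenvalues $\delta_1\le\dots\le\delta_d$, counted with multiplicity. Let $\mathcal G_3=\sum_{l=1}^d\delta_lZ_l^2$ with $Z_1,\dots,Z_d$ i.i.d. $N(0,1)$. Then the conditional distribution of $X_I^{2*}$ given $A$ converges to the distribution of $\mathcal G_3$,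 and under the independence hypothesis $H_0:\ p_{ij}=p_{i+}p_{+j}$ for all $i,j$, the conditional distribution of $W_I^*$ given $A$ converges to the same limit. Here convergence is in distribution, in probability: for every bounded continuous $f$, the conditional expectations $E\{f(X_I^{2*})\mid A\}$ and $E\{f(W_I^*)\mid A\}$ converge to $E f(\mathcal G_3)$ in probability. -/

import Mathlib

open MeasureTheory ProbabilityTheory Filter Topology

namespace SurveyTable

/-- The cells of a two-way table with `r + 1` rows and `c + 1` columns (so `R = r + 1`,
`C = c + 1`). -/
abbrev Cell (r c : ℕ) : Type := Fin (r + 1) × Fin (c + 1)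

/-- All cells except the last one `(R, C)`; these index the `RC - 1` free coordinates of a vector
of cell proportions. -/
abbrev FreeCell (r c : ℕ) : Type := {a : Cell r c // a ≠ (Fin.last r, Fin.last c)}

section Table

variable {r c : ℕ}

/-- The row margin `q_{i+}`. -/
def rowMargin (q : Cell r c → ℝ) (i : Fin (r + 1)) : ℝ := ∑ j, q (i, j)

/-- The column margin `q_{+j}`. -/
def colMargin (q : Cell r c → ℝ) (j : Fin (c + 1)) : ℝ := ∑ i, q (i, j)

/-- `q_{ij} - q_{i+} q_{+j}`. -/
def indepDiff (q : Cell r c → ℝ) (a : Cell r c) : ℝ :=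
  q a - rowMargin q a.1 * colMargin q a.2

/-- The hypothesis of independence, `q_{ij} = q_{i+} q_{+j}` for all `i, j`. -/
def Independence (q : Cell r c → ℝ) : Prop :=
  ∀ a : Cell r c, q a = rowMargin q a.1 * colMargin q a.2

/-- The vector of all cell proportions with given free coordinates. -/
def completion (q : FreeCell r c → ℝ) : Cell r c → ℝ := fun a =>
  if h : a ≠ (Fin.last r, Fin.last c) then q ⟨a, h⟩ else 1 - ∑ b, q b

/-- The map `h : ℝ^{RC-1} → ℝ^{(R-1)(C-1)}`, `h_{ij}(q) = q_{ij} - q_{i+} q_{+j}`,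
`1 ≤ i ≤ R - 1`, `1 ≤ j ≤ C - 1`. -/
def hMap (q : FreeCell r c → ℝ) : Fin r × Fin c → ℝ := fun a =>
  indepDiff (completion q) (a.1.castSucc, a.2.castSucc)

/-- The matrix of partial derivatives `H = ∂h(p)/∂pᵀ`, of size `(R-1)(C-1) × (RC-1)`. -/
noncomputable def jacobian (p : Cell r c → ℝ) : Matrix (Fin r × Fin c) (FreeCell r c) ℝ :=
  Matrix.of fun a b =>
    fderiv ℝ (fun q : FreeCell r c → ℝ => hMap q a) (fun b => p b.1) (Pi.single b 1)

/-- `P_{R+} = diag(p_{R+}) - p_{R+} p_{R+}ᵀ`, `p_{R+} = (p_{1+}, …, p_{R-1,+})ᵀ`. -/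
def rowCov (p : Cell r c → ℝ) : Matrix (Fin r) (Fin r) ℝ :=
  Matrix.diagonal (fun i => rowMargin p i.castSucc) -
    Matrix.vecMulVec (fun i => rowMargin p i.castSucc) (fun i => rowMargin p i.castSucc)

/-- `P_{+C} = diag(p_{+C}) - p_{+C} p_{+C}ᵀ`, `p_{+C} = (p_{+1}, …, p_{+,C-1})ᵀ`. -/
def colCov (p : Cell r c → ℝ) : Matrix (Fin c) (Fin c) ℝ :=
  Matrix.diagonal (fun j => colMargin p j.castSucc) -
    Matrix.vecMulVec (fun j => colMargin p j.castSucc) (fun j => colMargin p j.castSucc)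

/-- The design effect matrix `(P_{R+}⁻¹ ⊗ P_{+C}⁻¹) (H Σ_p Hᵀ)`. -/
noncomputable def designEffect (p : Cell r c → ℝ)
    (S : Matrix (FreeCell r c) (FreeCell r c) ℝ) : Matrix (Fin r × Fin c) (Fin r × Fin c) ℝ :=
  Matrix.kronecker (rowCov p)⁻¹ (colCov p)⁻¹ * (jacobian p * S * (jacobian p).transpose)

/-- The weighted cell proportion `∑_{i ∈ A, y_i = a} w_i / ∑_{i ∈ A} w_i`. -/
noncomputable def cellProp {ι : Type*} (A : Finset ι) (w : ι → ℝ) (y : ι → Cell r c) :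
    Cell r c → ℝ := fun a =>
  (∑ i ∈ A, if y i = a then w i else 0) / ∑ i ∈ A, w i

/-- The statistic `X_I^{2*}`, for sample size `n`, sample proportions `q` and bootstrap
proportions `q'`. -/
noncomputable def pearsonStat (n : ℝ) (q q' : Cell r c → ℝ) : ℝ :=
  n * ∑ a : Cell r c, (indepDiff q' a - indepDiff q a) ^ 2 / (rowMargin q a.1 * colMargin q a.2)

/-- `Δ_{ij} = q_{ij} / (q_{i+} q_{+j})`. -/
noncomputable def depRatio (q : Cell r c → ℝ) (a : Cell r c) : ℝ :=
  q a / (rowMargin q a.1 * colMargin q a.2)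

/-- The statistic `W_I^*`, for sample size `n`, sample proportions `q` and bootstrap
proportions `q'`. -/
noncomputable def lrStat (n : ℝ) (q q' : Cell r c → ℝ) : ℝ :=
  2 * n * ∑ a : Cell r c,
    (q' a * Real.log (q' a / (rowMargin q' a.1 * colMargin q' a.2 * depRatio q a)) -
      (q' a - rowMargin q' a.1 * colMargin q' a.2 * depRatio q a))

theorem row_free (i : Fin r) (j : Fin (c + 1)) :
    ((i.castSucc, j) : Cell r c) ≠ (Fin.last r, Fin.last c) := fun h =>
  (Fin.castSucc_lt_last i).ne (congrArg Prod.fst h)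

theorem col_free (i : Fin (r + 1)) (j : Fin c) :
    ((i, j.castSucc) : Cell r c) ≠ (Fin.last r, Fin.last c) := fun h =>
  (Fin.castSucc_lt_last j).ne (congrArg Prod.snd h)

theorem hMap_apply (q : FreeCell r c → ℝ) (a : Fin r × Fin c) :
    hMap q a = q ⟨(a.1.castSucc, a.2.castSucc), row_free _ _⟩ -
      (∑ j, q ⟨(a.1.castSucc, j), row_free _ _⟩) *
        ∑ i, q ⟨(i, a.2.castSucc), col_free _ _⟩ := by
  simp only [hMap, indepDiff, rowMargin, colMargin, completion, dif_pos (row_free _ _),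
    dif_pos (col_free _ _)]

/-- The entries of the Jacobian: `∂h_{ij}/∂p_{kl} = 1{(k,l) = (i,j)} - 1{k = i} p_{+j} -
p_{i+} 1{l = j}`. -/
theorem jacobian_apply (p : Cell r c → ℝ) (a : Fin r × Fin c) (b : FreeCell r c) :
    jacobian p a b =
      (if b.1 = (a.1.castSucc, a.2.castSucc) then 1 else 0) -
        ((if b.1.1 = a.1.castSucc then colMargin p a.2.castSucc else 0) +
          (if b.1.2 = a.2.castSucc then rowMargin p a.1.castSucc else 0)) := by
  have hproj : ∀ d : FreeCell r c, HasFDerivAt (fun q : FreeCell r c → ℝ => q d)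
      (ContinuousLinearMap.proj (R := ℝ) (φ := fun _ : FreeCell r c => ℝ) d)
      (fun b => p b.1) := fun d =>
    (ContinuousLinearMap.proj (R := ℝ) (φ := fun _ : FreeCell r c => ℝ) d).hasFDerivAt
  have h1 := HasFDerivAt.fun_sum (u := Finset.univ)
    (fun (j : Fin (c + 1)) _ => hproj ⟨(a.1.castSucc, j), row_free _ _⟩)
  have h2 := HasFDerivAt.fun_sum (u := Finset.univ)
    (fun (i : Fin (r + 1)) _ => hproj ⟨(i, a.2.castSucc), col_free _ _⟩)
  have h := (hproj ⟨(a.1.castSucc, a.2.castSucc), row_free _ _⟩).sub (h1.mul h2)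
  have hf : (fun q : FreeCell r c → ℝ => hMap q a) = _ := funext fun q => hMap_apply q a
  simp only [jacobian, Matrix.of_apply, hf]
  erw [h.fderiv]
  obtain ⟨⟨k, l⟩, hb⟩ := b
  simp only [sub_apply, add_apply,
    smul_apply, sum_apply, ContinuousLinearMap.proj_apply,
    Pi.single_apply, Subtype.mk.injEq, Prod.mk.injEq, smul_eq_mul, colMargin, rowMargin]
  have e1 : (∑ x : Fin (r + 1), if x = k ∧ a.2.castSucc = l then (1 : ℝ) else 0) =
      if l = a.2.castSucc then 1 else 0 := by
    by_cases hl : l = a.2.castSucc <;> simp [hl, eq_comm]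
  have e2 : (∑ x : Fin (c + 1), if a.1.castSucc = k ∧ x = l then (1 : ℝ) else 0) =
      if k = a.1.castSucc then 1 else 0 := by
    by_cases hk : k = a.1.castSucc <;> simp [hk, eq_comm]
  rw [e1, e2]
  simp only [mul_ite, mul_one, mul_zero, eq_comm]
  ring

end Table

section Sampling

/-- `i ∈ A` as a zero-one variable. -/
def inclusion {ι Ω : Type*} [DecidableEq ι] (A : Ω → Finset ι) (i : ι) (ω : Ω) : ℝ :=
  if i ∈ A ω then 1 else 0

/-- Poisson sampling from a finite population of `N` units. Unit `i` has category `y i` and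
inclusion probability `incl i`, and `A` is the selected sample. The units are independent, and given
its category and its inclusion probability unit `i` is selected with probability `incl i`. -/
structure IsPoissonSample {K Ω : Type*} [MeasurableSpace K] [MeasurableSpace Ω] (P : Measure Ω)
    {N : ℕ} (y : Fin N → Ω → K) (incl : Fin N → Ω → ℝ) (A : Ω → Finset (Fin N)) : Prop where
  measurable_cat : ∀ i, Measurable (y i)
  measurable_incl : ∀ i, Measurable (incl i)
  measurable_sample : ∀ i, Measurable (inclusion A i)
  indep : iIndepFun (fun i ω => (y i ω, incl i ω, inclusion A i ω)) P
  selection : ∀ i,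
    P[inclusion A i | MeasurableSpace.comap (fun ω => (y i ω, incl i ω)) inferInstance]
      =ᵐ[P] incl i

/-- The expected sample size `n₀`, the expectation of the sum of the inclusion probabilities. -/
noncomputable def expectedSize {Ω : Type*} [MeasurableSpace Ω] (P : Measure Ω) {N : ℕ}
    (incl : Fin N → Ω → ℝ) : ℝ := ∑ i, ∫ ω, incl i ω ∂P

/-- The design-weighted mean `N⁻¹ ∑_{i ∈ A} w_i (1{y_i = a} - p_a)`, `w_i = 1 / incl i`: the
weighted estimating function of the cell proportions at `p`, whose root is the vector of
weighted sample proportions. -/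
noncomputable def weightedScore {r c N : ℕ} {Ω : Type*} (p : Cell r c → ℝ)
    (y : Fin N → Ω → Cell r c) (incl : Fin N → Ω → ℝ) (A : Ω → Finset (Fin N))
    (a : Cell r c) (ω : Ω) : ℝ :=
  (∑ i ∈ A ω, (incl i ω)⁻¹ * ((if y i ω = a then 1 else 0) - p a)) / N

/-- The bootstrap distribution of the counts `(m_i^*)_{i ∈ A}` given the sample `A` with inclusion
probabilities `incl`: `(N_i^*)_{i ∈ A}` is multinomial with `N` trials and probabilities
proportional to `1 / incl i`, and given these the `m_i^*` are independent binomial with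
`N_i^*` trials and success probability `incl i`. Both families are zero outside `A`. -/
noncomputable def bootLaw {ι : Type*} [Fintype ι] [DecidableEq ι] (N : ℕ) (A : Finset ι)
    (incl : ι → ℝ) : Measure (ι → ℕ) :=
  ∑ k ∈ A.piAntidiag N, ∑ m ∈ Fintype.piFinset (fun i => Finset.range (k i + 1)),
    ENNReal.ofReal
      ((Nat.multinomial A k * ∏ i ∈ A, ((incl i)⁻¹ / ∑ j ∈ A, (incl j)⁻¹) ^ k i) *
        ∏ i ∈ A, ((k i).choose (m i) * incl i ^ m i * (1 - incl i) ^ (k i - m i))) •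
      Measure.dirac m

/-- The cell proportions computed from the sampling weights `w_i = 1 / incl i`. -/
noncomputable def sampleProp {r c : ℕ} {ι : Type*} (A : Finset ι) (incl : ι → ℝ)
    (y : ι → Cell r c) : Cell r c → ℝ :=
  cellProp A (fun i => (incl i)⁻¹) y

/-- The cell proportions computed from the bootstrap weights `w_i^* = w_i m_i^*`. -/
noncomputable def bootProp {r c : ℕ} {ι : Type*} (A : Finset ι) (incl : ι → ℝ)
    (y : ι → Cell r c) (m : ι → ℕ) : Cell r c → ℝ :=
  cellProp A (fun i => (incl i)⁻¹ * m i) y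

/-- The bootstrap distribution, given the sample, of the statistic
`T (n) (sample proportions) (bootstrap proportions)`, with `n` the realized sample size. -/
noncomputable def bootStatLaw {r c N : ℕ} (T : ℝ → (Cell r c → ℝ) → (Cell r c → ℝ) → ℝ)
    (A : Finset (Fin N)) (incl : Fin N → ℝ) (y : Fin N → Cell r c) : Measure ℝ :=
  (bootLaw N A incl).map fun m => T A.card (sampleProp A incl y) (bootProp A incl y m)

/-- Convergence in distribution, in probability, of random laws `L ν` on the real line to the
law `G`. -/
def TendstoConditionally {Ω : ℕ → Type*} [∀ ν, MeasurableSpace (Ω ν)]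
    (P : ∀ ν, Measure (Ω ν)) (L : ∀ ν, Ω ν → Measure ℝ) (G : Measure ℝ) : Prop :=
  ∀ f : BoundedContinuousFunction ℝ ℝ, ∀ ε : ℝ, 0 < ε →
    Tendsto (fun ν => P ν {ω | ε ≤ |∫ x, f x ∂(L ν ω) - ∫ x, f x ∂G|}) atTop (𝓝 0)

/-- The law of `∑ δ_l Z_l²` with `Z_l` independent standard normal. -/
noncomputable def weightedChiSq {d : ℕ} (δ : Fin d → ℝ) : Measure ℝ :=
  (Measure.pi fun _ : Fin d => gaussianReal 0 1).map fun z => ∑ l, δ l * z l ^ 2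

end Sampling

end SurveyTable

open SurveyTable

/-! Given the sample, the two-stage bootstrap is a single multinomial. A trial hits unit `k` with
probability `w_k / W`, where `W = ∑ w_k`, and thinning keeps it with probability `π_k = 1 / w_k`, so
each sampled unit is retained with the same probability `1 / W`. The characteristic function of a
linear form in the counts is therefore an exact `N`-th power (`integral_prod_pow_bootLaw`). In the
limit only the sum and the sum of squares of the coefficients matter (`tendsto_sum_cexp_sub_one`,
`tendsto_one_add_pow_cexp`).

This is applied jointly to the bootstrap total `N⁻¹ ∑ w m` and to the score centred at the sample
proportions and scaled by `√n`. The total tends to 1; the score has conditional mean zero and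
conditional covariance tending to `Σ_p` (`exists_tendsto_bootVec`). The difference of bootstrap and
sample proportions equals `n^{-1/2}` times score over total (`statOfVec_bootVec`). Both statistics,
as functions of the rescaled difference `u`, converge continuously to the same quadratic form
`chiForm p u` (`tendsto_pearsonStat`, `tendsto_lrStat`). The extended continuous mapping theorem
carries the weak limit over.

The form equals `gᵀ (P_{R+}⁻¹ ⊗ P_{+C}⁻¹) g` with `g = H s`. Factoring the kernel as `CᵀC` makes it
the squared norm of a Gaussian vector with covariance `C H Σ_p Hᵀ Cᵀ`. This symmetric matrix has the
characteristic polynomial of `D_h`, since `XY` and `YX` share theirs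
(`exists_spectrum_designEffect`).

All this is deterministic along a sequence of samples with stable size, weighted means and weighted
second moments (`RegularSamples`). Under Poisson sampling these finitely many quantities converge in
probability by Chebyshev's inequality. The second moments have the limit `Σ_p` because they differ
in mean from the scaled covariance by `O(n₀ / N)`. Finally `tendsto_measure_of_forall_seq` turns
limits along sequences of outcomes into limits in probability. -/

namespace SurveyTable

/-! ### The bootstrap counts given the sample. -/

section BootLaw

variable {ι : Type*}

/-- The real mass of the pair `(N^*, m^*)` in the bootstrap distribution. -/
noncomputable def bootMass (A : Finset ι) (incl : ι → ℝ) (k m : ι → ℕ) : ℝ :=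
  (Nat.multinomial A k * ∏ i ∈ A, ((incl i)⁻¹ / ∑ j ∈ A, (incl j)⁻¹) ^ k i) *
    ∏ i ∈ A, ((k i).choose (m i) * incl i ^ m i * (1 - incl i) ^ (k i - m i))

theorem bootMass_nonneg {A : Finset ι} {incl : ι → ℝ} (h0 : ∀ i ∈ A, 0 ≤ incl i)
    (h1 : ∀ i ∈ A, incl i ≤ 1) (k m : ι → ℕ) : 0 ≤ bootMass A incl k m := by
  unfold bootMass
  refine mul_nonneg (mul_nonneg (by positivity) (Finset.prod_nonneg fun i hi => ?_))
    (Finset.prod_nonneg fun i hi => ?_)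
  · exact pow_nonneg (div_nonneg (inv_nonneg.2 (h0 i hi))
      (Finset.sum_nonneg fun j hj => inv_nonneg.2 (h0 j hj))) _
  · exact mul_nonneg (mul_nonneg (by positivity) (pow_nonneg (h0 i hi) _))
      (pow_nonneg (sub_nonneg.2 (h1 i hi)) _)

variable [Fintype ι] [DecidableEq ι]

instance isFiniteMeasure_bootLaw (N : ℕ) (A : Finset ι) (incl : ι → ℝ) :
    IsFiniteMeasure (bootLaw N A incl) := by
  refine ⟨?_⟩
  simp only [bootLaw, Measure.coe_finsetSum, Finset.sum_apply, Measure.smul_apply, smul_eq_mul]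
  exact ENNReal.sum_lt_top.2 fun k _ => ENNReal.sum_lt_top.2 fun m _ =>
    ENNReal.mul_lt_top ENNReal.ofReal_lt_top (measure_lt_top _ _)

/-- `ENNReal.ofReal` truncates negative numbers to zero; inclusion probabilities in `[0, 1]` make
the masses nonnegative, so nothing is lost. -/
theorem integral_bootLaw {A : Finset ι} {incl : ι → ℝ} (N : ℕ) (h0 : ∀ i ∈ A, 0 ≤ incl i)
    (h1 : ∀ i ∈ A, incl i ≤ 1) (f : (ι → ℕ) → ℂ) :
    ∫ m, f m ∂(bootLaw N A incl) =
      ∑ k ∈ A.piAntidiag N, ∑ m ∈ Fintype.piFinset (fun i => Finset.range (k i + 1)),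
        (bootMass A incl k m : ℂ) * f m := by
  have hint : ∀ (k m : ι → ℕ), Integrable f
      (ENNReal.ofReal (bootMass A incl k m) • Measure.dirac m) := fun k m =>
    (integrable_dirac (enorm_lt_top)).smul_measure ENNReal.ofReal_ne_top
  change ∫ m, f m ∂(∑ k ∈ A.piAntidiag N,
    ∑ m ∈ Fintype.piFinset (fun i => Finset.range (k i + 1)),
      ENNReal.ofReal (bootMass A incl k m) • Measure.dirac m) = _
  rw [integral_finsetSum_measure fun k _ => integrable_finsetSum_measure.2 fun m _ => hint k m]
  refine Finset.sum_congr rfl fun k _ => ?_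
  rw [integral_finsetSum_measure fun m _ => hint k m]
  refine Finset.sum_congr rfl fun m _ => ?_
  rw [integral_smul_measure, integral_dirac, ENNReal.toReal_ofReal (bootMass_nonneg h0 h1 k m)]
  simp

/-- The joint generating function of the bootstrap counts: together with the number of discarded
trials they are multinomial, with equal probabilities `1 / ∑ w_i`. -/
theorem integral_prod_pow_bootLaw {A : Finset ι} {incl : ι → ℝ} (N : ℕ) (hA : A.Nonempty)
    (h0 : ∀ i ∈ A, 0 < incl i) (h1 : ∀ i ∈ A, incl i ≤ 1) (z : ι → ℂ) :
    ∫ m, ∏ i ∈ A, z i ^ m i ∂(bootLaw N A incl) =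
      (1 + ((∑ i ∈ A, (incl i)⁻¹ : ℝ) : ℂ)⁻¹ * ∑ i ∈ A, (z i - 1)) ^ N := by
  set W : ℝ := ∑ i ∈ A, (incl i)⁻¹ with hW
  have hWpos : 0 < W := Finset.sum_pos (fun i hi => inv_pos.2 (h0 i hi)) hA
  have hWc : (W : ℂ) ≠ 0 := by exact_mod_cast hWpos.ne'
  rw [integral_bootLaw N (fun i hi => (h0 i hi).le) h1]
  -- The right-hand side is the generating function of one trial: hit `i`, then keep or discard. The
  -- factor `incl i` cancels the weight, leaving `(z i - 1) / W`. The multinomial theorem then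
  -- expands over `N^*` and the binomial theorem over `m^*`.
  have hbase : 1 + (W : ℂ)⁻¹ * ∑ i ∈ A, (z i - 1) =
      ∑ i ∈ A, (((incl i)⁻¹ / W : ℝ) : ℂ) * (incl i * z i + (1 - incl i)) := by
    have hsum : (∑ i ∈ A, (((incl i)⁻¹ / W : ℝ) : ℂ)) = 1 := by
      rw [← Complex.ofReal_sum, ← Finset.sum_div, ← hW, div_self hWpos.ne', Complex.ofReal_one]
    have hterm : ∀ i ∈ A, (((incl i)⁻¹ / W : ℝ) : ℂ) * (incl i * z i + (1 - incl i)) =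
        (((incl i)⁻¹ / W : ℝ) : ℂ) + (W : ℂ)⁻¹ * (z i - 1) := fun i hi => by
      have hi0 : (incl i : ℂ) ≠ 0 := by exact_mod_cast (h0 i hi).ne'
      push_cast
      field_simp
      ring
    rw [Finset.sum_congr rfl hterm, Finset.sum_add_distrib, hsum, Finset.mul_sum]
  rw [hbase, Finset.sum_pow_eq_sum_piAntidiag]
  refine Finset.sum_congr rfl fun k hk => ?_
  have hout : ∀ i, i ∉ A → k i = 0 := fun i hi => by
    by_contra h
    exact hi ((Finset.mem_piAntidiag.1 hk).2 i h)
  have hprod : ∏ i ∈ A, (incl i * z i + (1 - incl i)) ^ k i =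
      ∑ m ∈ Fintype.piFinset (fun i => Finset.range (k i + 1)),
        ∏ i ∈ A, ((incl i * z i) ^ m i * (1 - (incl i : ℂ)) ^ (k i - m i) *
          ((k i).choose (m i) : ℂ)) := by
    -- Extending the product to all of `ι` by factors 1 lets it distribute over the sums; outside
    -- `A` the count `k i` is zero, so the only available `m i` is zero.
    have : ∏ i ∈ A, (incl i * z i + (1 - incl i)) ^ k i =
        ∏ i, if i ∈ A then (incl i * z i + (1 - incl i)) ^ k i else 1 := by
      rw [Finset.prod_ite_mem, Finset.univ_inter]
    rw [this]
    have h2 : ∀ i, (if i ∈ A then (incl i * z i + (1 - incl i)) ^ k i else 1) =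
        ∑ m ∈ Finset.range (k i + 1), if i ∈ A then
          ((incl i * z i) ^ m * (1 - (incl i : ℂ)) ^ (k i - m) * ((k i).choose m : ℂ)) else 1 := by
      intro i
      split_ifs with hi
      · rw [add_pow]
      · simp [hout i hi]
    simp only [h2]
    rw [Finset.prod_univ_sum]
    refine Finset.sum_congr rfl fun m _ => ?_
    rw [Finset.prod_ite_mem, Finset.univ_inter]
  simp only [mul_pow (((_ : ℝ) : ℂ)), Finset.prod_mul_distrib]
  rw [hprod, Finset.mul_sum, Finset.mul_sum]
  refine Finset.sum_congr rfl fun m _ => ?_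
  simp only [bootMass, ← hW, mul_pow, Finset.prod_mul_distrib]
  push_cast
  ring

/-- The total mass is the generating function at `z = 1`. -/
theorem isProbabilityMeasure_bootLaw {A : Finset ι} {incl : ι → ℝ} (N : ℕ) (hA : A.Nonempty)
    (h0 : ∀ i ∈ A, 0 < incl i) (h1 : ∀ i ∈ A, incl i ≤ 1) :
    IsProbabilityMeasure (bootLaw N A incl) := by
  have h := integral_prod_pow_bootLaw N hA h0 h1 (fun _ => 1)
  simp only [one_pow, Finset.prod_const_one, sub_self, Finset.sum_const_zero, mul_zero, add_zero,
    integral_const, Complex.real_smul, mul_one] at h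
  refine ⟨?_⟩
  rw [← ENNReal.toReal_eq_one_iff]
  exact_mod_cast h

end BootLaw

/-! ### Characteristic functions of null arrays, and continuous mapping. -/

section Analysis

/-- Convergence of `M g` with `M → ∞` forces `g → 0`, so `log (1 + g) = g + O(g²)`, and `M g² = (M
g) g` vanishes. -/
theorem tendsto_one_add_pow_cexp {κ : Type*} {l : Filter κ} {M : κ → ℕ} {g : κ → ℂ} {t : ℂ}
    (hM : Tendsto M l atTop) (h : Tendsto (fun j => (M j : ℂ) * g j) l (𝓝 t)) :
    Tendsto (fun j => (1 + g j) ^ M j) l (𝓝 (Complex.exp t)) := by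
  have hMinv : Tendsto (fun j => ((M j : ℂ))⁻¹) l (𝓝 0) := by
    have := (tendsto_inv_atTop_zero (𝕜 := ℝ)).comp (tendsto_natCast_atTop_atTop.comp hM)
    have h2 := (Complex.continuous_ofReal.tendsto 0).comp this
    simpa [Function.comp_def] using h2
  have hne : ∀ᶠ j in l, (M j : ℂ) ≠ 0 := by
    filter_upwards [hM.eventually_ne_atTop 0] with j hj
    exact_mod_cast hj
  have hg : Tendsto g l (𝓝 0) := by
    have := hMinv.mul h
    rw [zero_mul] at this
    refine this.congr' ?_
    filter_upwards [hne] with j hj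
    field_simp
  have hlog : Tendsto (fun j => (M j : ℂ) * Complex.log (1 + g j)) l (𝓝 t) := by
    obtain ⟨K, hK⟩ := (Complex.log_sub_self_isBigO.comp_tendsto hg).bound
    have hz : Tendsto (fun j => (M j : ℂ) * (Complex.log (1 + g j) - g j)) l (𝓝 0) := by
      rw [tendsto_zero_iff_norm_tendsto_zero]
      have hb : Tendsto (fun j => K * ‖(M j : ℂ) * g j‖ * ‖g j‖) l (𝓝 0) := by
        simpa using (h.norm.const_mul K).mul hg.norm
      refine squeeze_zero' (Eventually.of_forall fun j => norm_nonneg _) ?_ hb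
      filter_upwards [hK] with j hj
      simp only [Function.comp_apply, norm_pow] at hj
      rw [norm_mul, norm_mul]
      calc ‖(M j : ℂ)‖ * ‖Complex.log (1 + g j) - g j‖ ≤ ‖(M j : ℂ)‖ * (K * ‖g j‖ ^ 2) := by gcongr
        _ = _ := by ring
    simpa [mul_sub] using hz.add h
  refine ((Complex.continuous_exp.tendsto t).comp hlog).congr' ?_
  have hne1 : ∀ᶠ j in l, 1 + g j ≠ 0 := by
    have : Tendsto (fun j => 1 + g j) l (𝓝 1) := by simpa using hg.const_add 1
    exact this.eventually_ne one_ne_zero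
  filter_upwards [hne1] with j hj
  rw [Function.comp_apply, Complex.exp_nat_mul, Complex.exp_log hj]

theorem norm_cexp_mul_I_sub_taylor_le (x : ℝ) :
    ‖Complex.exp (x * Complex.I) - 1 - (x * Complex.I - ((x ^ 2 : ℝ) : ℂ) / 2)‖ ≤
      |x| ^ 3 * Real.exp |x| := by
  have h := Complex.norm_exp_sub_sum_le_norm_mul_exp ((x : ℂ) * Complex.I) 3
  have hI : ((x : ℂ) * Complex.I) ^ 2 = -((x ^ 2 : ℝ) : ℂ) := by
    rw [mul_pow, Complex.I_sq]; push_cast; ring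
  simp only [Finset.sum_range_succ, Finset.sum_range_zero, hI, norm_mul, Complex.norm_I,
    Complex.norm_real, Real.norm_eq_abs, mul_one] at h
  convert! h using 2
  simp [Nat.factorial]
  ring

/-- Second order expansion of the sum of the centred characters of a null array. -/
theorem tendsto_sum_cexp_sub_one {κ : Type*} {l : Filter κ} {ι : κ → Type*}
    {s : ∀ j, Finset (ι j)} {x : ∀ j, ι j → ℝ} {c b : κ → ℝ} {m v : ℝ}
    (hc : ∀ᶠ j in l, 0 ≤ c j) (hb : Tendsto b l (𝓝 0))
    (hxb : ∀ᶠ j in l, ∀ i ∈ s j, |x j i| ≤ b j)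
    (h1 : Tendsto (fun j => c j * ∑ i ∈ s j, x j i) l (𝓝 m))
    (h2 : Tendsto (fun j => c j * ∑ i ∈ s j, x j i ^ 2) l (𝓝 v)) :
    Tendsto (fun j => (c j : ℂ) * ∑ i ∈ s j, (Complex.exp (x j i * Complex.I) - 1)) l
      (𝓝 (m * Complex.I - v / 2)) := by
  have hmain : Tendsto (fun j => ((c j * ∑ i ∈ s j, x j i : ℝ) : ℂ) * Complex.I -
      ((c j * ∑ i ∈ s j, x j i ^ 2 : ℝ) : ℂ) / 2) l (𝓝 (m * Complex.I - v / 2)) :=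
    (((Complex.continuous_ofReal.tendsto m).comp h1).mul_const _).sub
      (((Complex.continuous_ofReal.tendsto v).comp h2).div_const _)
  have hbexp : Tendsto (fun j => b j * Real.exp (b j)) l (𝓝 0) := by
    simpa using hb.mul ((Real.continuous_exp.tendsto 0).comp hb)
  have herr : Tendsto (fun j => (c j : ℂ) * ∑ i ∈ s j, (Complex.exp (x j i * Complex.I) - 1) -
      (((c j * ∑ i ∈ s j, x j i : ℝ) : ℂ) * Complex.I -
      ((c j * ∑ i ∈ s j, x j i ^ 2 : ℝ) : ℂ) / 2)) l (𝓝 0) := by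
    rw [tendsto_zero_iff_norm_tendsto_zero]
    -- Each cubic error is at most `x² b exp b`, so the total error is the convergent sum of squares
    -- times a null factor.
    have hlim : Tendsto (fun j => (c j * ∑ i ∈ s j, x j i ^ 2) * (b j * Real.exp (b j))) l
        (𝓝 0) := by simpa using h2.mul hbexp
    refine squeeze_zero' (Eventually.of_forall fun j => norm_nonneg _) ?_ hlim
    filter_upwards [hc, hxb] with j hcj hj
    have e : (c j : ℂ) * ∑ i ∈ s j, (Complex.exp (x j i * Complex.I) - 1) -
        (((c j * ∑ i ∈ s j, x j i : ℝ) : ℂ) * Complex.I -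
          ((c j * ∑ i ∈ s j, x j i ^ 2 : ℝ) : ℂ) / 2) =
        (c j : ℂ) * ∑ i ∈ s j, (Complex.exp (x j i * Complex.I) - 1 -
          (x j i * Complex.I - ((x j i ^ 2 : ℝ) : ℂ) / 2)) := by
      push_cast
      rw [Finset.sum_sub_distrib (g := fun i => (x j i : ℂ) * Complex.I - (x j i : ℂ) ^ 2 / 2),
        Finset.sum_sub_distrib (f := fun i => (x j i : ℂ) * Complex.I), ← Finset.sum_mul,
        ← Finset.sum_div]
      ring
    rw [e, norm_mul, Complex.norm_real, Real.norm_eq_abs, abs_of_nonneg hcj, mul_assoc]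
    refine mul_le_mul_of_nonneg_left ?_ hcj
    rw [Finset.sum_mul]
    refine (norm_sum_le _ _).trans (Finset.sum_le_sum fun i hi => ?_)
    refine (norm_cexp_mul_I_sub_taylor_le _).trans ?_
    have hi' := hj i hi
    rw [← sq_abs (x j i), show |x j i| ^ 3 = |x j i| ^ 2 * |x j i| by ring, mul_assoc]
    gcongr
    exact (abs_nonneg _).trans hi'
  simpa using herr.add hmain

/-- The extended continuous mapping theorem: weak convergence is preserved by maps that converge
continuously at almost every point of the limit. -/
theorem tendsto_integral_comp_of_continuous_convergence {E : Type*} [MeasurableSpace E]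
    [TopologicalSpace E] [OpensMeasurableSpace E] [HasOuterApproxClosed E]
    {μ : ℕ → ProbabilityMeasure E} {μ₀ : ProbabilityMeasure E} (hμ : Tendsto μ atTop (𝓝 μ₀))
    {G : ℕ → E → ℝ} {G₀ : E → ℝ} (hG : ∀ j, Measurable (G j)) (hG₀ : Measurable G₀)
    (h : ∀ᵐ x ∂(μ₀ : Measure E),
      Tendsto (fun q : ℕ × E => G q.1 q.2) (atTop ×ˢ 𝓝 x) (𝓝 (G₀ x)))
    (f : BoundedContinuousFunction ℝ ℝ) :
    Tendsto (fun j => ∫ x, f (G j x) ∂(μ j : Measure E)) atTop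
      (𝓝 (∫ x, f (G₀ x) ∂(μ₀ : Measure E))) := by
  have key : Tendsto (fun j => (μ j).map (hG j).aemeasurable) atTop
      (𝓝 (μ₀.map hG₀.aemeasurable)) := by
    refine tendsto_of_forall_isClosed_limsup_le' fun F hF => ?_
    simp only [ProbabilityMeasure.toMeasure_map]
    rw [Measure.map_apply hG₀ hF.measurableSet]
    have hmap : ∀ j, (μ j : Measure E).map (G j) F = (μ j : Measure E) (G j ⁻¹' F) := fun j =>
      Measure.map_apply (hG j) hF.measurableSet
    simp only [hmap]
    -- The portmanteau bound needs one closed set for all large `j`: `C k` contains every `G j ⁻¹'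
    -- F` with `j ≥ k`. These sets decrease, and almost every point of their intersection lies in
    -- `G₀ ⁻¹' F`.
    set C : ℕ → Set E := fun k => closure (⋃ j ≥ k, G j ⁻¹' F) with hC
    have hle : ∀ k, limsup (fun j => (μ j : Measure E) (G j ⁻¹' F)) atTop ≤
        (μ₀ : Measure E) (C k) := fun k => by
      refine le_trans (limsup_le_limsup ?_)
        (ProbabilityMeasure.limsup_measure_closed_le_of_tendsto hμ isClosed_closure)
      filter_upwards [eventually_ge_atTop k] with j hj
      exact measure_mono ((Set.subset_biUnion_of_mem (u := fun j => G j ⁻¹' F) hj).trans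
        subset_closure)
    have hanti : Antitone C := fun a b hab => closure_mono
      (Set.biUnion_subset_biUnion_left fun j (hj : b ≤ j) => hab.trans hj)
    have hlim := tendsto_measure_iInter_atTop (μ := (μ₀ : Measure E)) (s := C)
      (fun k => isClosed_closure.measurableSet.nullMeasurableSet) hanti
      ⟨0, measure_ne_top _ _⟩
    refine (ge_of_tendsto' hlim hle).trans (measure_mono_ae ?_)
    filter_upwards [h] with x hx
    intro hxC
    change x ∈ ⋂ k, C k at hxC
    change G₀ x ∈ F
    by_contra hxF
    -- If `G₀ x ∉ F`, continuous convergence keeps `G j z` outside `F` for all large `j` and all `z`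
    -- near `x`, whereas `x ∈ C k` supplies such a `z` with `G j z ∈ F`.
    have hev := hx.eventually (hF.isOpen_compl.mem_nhds hxF)
    rw [Filter.eventually_iff, Filter.mem_prod_iff] at hev
    obtain ⟨s, hs, U, hU, hsU⟩ := hev
    obtain ⟨k, hk⟩ := mem_atTop_sets.1 hs
    have hxk := Set.mem_iInter.1 hxC k
    obtain ⟨z, hzU, hz⟩ := mem_closure_iff_nhds.1 hxk U hU
    simp only [Set.mem_iUnion] at hz
    obtain ⟨j, hj, hzF⟩ := hz
    exact hsU (Set.mk_mem_prod (hk j hj) hzU) hzF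
  have := (ProbabilityMeasure.tendsto_iff_forall_integral_tendsto.1 key) f
  simp only [ProbabilityMeasure.toMeasure_map] at this
  rw [integral_map hG₀.aemeasurable f.continuous.aestronglyMeasurable] at this
  refine this.congr fun j => ?_
  rw [integral_map (hG j).aemeasurable f.continuous.aestronglyMeasurable]

end Analysis

/-! ### Joint weak limit of the bootstrap total and score along regular samples. -/

section BootstrapLimit

variable {r c : ℕ}

/-- A deterministic sequence of samples whose first and second weighted moments stabilize. -/
structure RegularSamples (p : Cell r c → ℝ) (Sp : Matrix (FreeCell r c) (FreeCell r c) ℝ)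
    (C₁ C₂ : ℝ) (N : ℕ → ℕ) (n₀ : ℕ → ℝ) (A : ∀ j, Finset (Fin (N j)))
    (incl : ∀ j, Fin (N j) → ℝ) (y : ∀ j, Fin (N j) → Cell r c) : Prop where
  size : Tendsto n₀ atTop atTop
  fraction : Tendsto (fun j => n₀ j / N j) atTop (𝓝 0)
  bounds : ∀ᶠ j in atTop, ∀ i, C₁ ≤ N j / n₀ j * incl j i ∧ N j / n₀ j * incl j i ≤ C₂
  card : Tendsto (fun j => (A j).card / n₀ j) atTop (𝓝 1)
  mean : ∀ a, Tendsto (fun j => (∑ i ∈ A j, if y j i = a then (incl j i)⁻¹ else 0) / N j) atTop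
    (𝓝 (p a))
  second : ∀ a b : FreeCell r c, Tendsto (fun j => n₀ j / (N j : ℝ) ^ 2 * ∑ i ∈ A j,
    (incl j i)⁻¹ ^ 2 * ((if y j i = a.1 then 1 else 0) - p a.1) *
      ((if y j i = b.1 then 1 else 0) - p b.1)) atTop (𝓝 (Sp a b))

theorem sum_cell_ite {ι : Type*} (A : Finset ι) (w : ι → ℝ) (y : ι → Cell r c) :
    ∑ a, ∑ i ∈ A, (if y i = a then w i else 0) = ∑ i ∈ A, w i := by
  rw [Finset.sum_comm]
  simp

theorem sum_cellProp {ι : Type*} {A : Finset ι} {w : ι → ℝ} (y : ι → Cell r c)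
    (h : ∑ i ∈ A, w i ≠ 0) : ∑ a, cellProp A w y a = 1 := by
  simp only [cellProp]
  rw [← Finset.sum_div, sum_cell_ite, div_self h]

theorem cellProp_mem_Icc {ι : Type*} {A : Finset ι} {w : ι → ℝ} (y : ι → Cell r c)
    (h : ∀ i ∈ A, 0 ≤ w i) (a : Cell r c) : cellProp A w y a ∈ Set.Icc (0 : ℝ) 1 := by
  have h0 : ∀ i ∈ A, 0 ≤ if y i = a then w i else 0 := fun i hi => by
    split_ifs
    exacts [h i hi, le_rfl]
  refine ⟨div_nonneg (Finset.sum_nonneg h0) (Finset.sum_nonneg h),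
    div_le_one_of_le₀ (Finset.sum_le_sum fun i hi => ?_) (Finset.sum_nonneg h)⟩
  split_ifs
  exacts [le_rfl, h i hi]

namespace RegularSamples

variable {p : Cell r c → ℝ} {Sp : Matrix (FreeCell r c) (FreeCell r c) ℝ} {C₁ C₂ : ℝ}
  {N : ℕ → ℕ} {n₀ : ℕ → ℝ} {A : ∀ j, Finset (Fin (N j))} {incl : ∀ j, Fin (N j) → ℝ}
  {y : ∀ j, Fin (N j) → Cell r c}

/-- The upper bound with `n₀ / N → 0` brings the inclusion probabilities below 1; the lower bound
makes them positive and the weights `O(N / n₀)`. The sample is nonempty because its size is of order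
`n₀`. -/
theorem eventually_pos (h : RegularSamples p Sp C₁ C₂ N n₀ A incl y) (hC₁ : 0 < C₁) :
    ∀ᶠ j in atTop, 0 < n₀ j ∧ 0 < N j ∧ (A j).Nonempty ∧
      ∀ i, 0 < incl j i ∧ incl j i ≤ 1 ∧ (incl j i)⁻¹ ≤ N j / (C₁ * n₀ j) := by
  have hsmall : Tendsto (fun j => C₂ * (n₀ j / N j)) atTop (𝓝 0) := by
    simpa using h.fraction.const_mul C₂
  filter_upwards [h.size.eventually_gt_atTop 0, h.bounds,
    h.card.eventually_const_lt (show (0 : ℝ) < 1 by norm_num),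
    hsmall.eventually_lt_const (show (0 : ℝ) < 1 by norm_num)] with j hn hb hc hs
  have hA : (A j).Nonempty := by
    rw [Finset.nonempty_iff_ne_empty]
    rintro h0
    simp [h0] at hc
  obtain ⟨k, hk⟩ := hA
  have hN : 0 < N j := k.pos
  have hN' : (0 : ℝ) < N j := by exact_mod_cast hN
  refine ⟨hn, hN, ⟨k, hk⟩, fun i => ?_⟩
  obtain ⟨h1, h2⟩ := hb i
  have hpos : 0 < incl j i := by
    by_contra hneg
    have : N j / n₀ j * incl j i ≤ 0 := mul_nonpos_of_nonneg_of_nonpos (by positivity)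
      (not_lt.1 hneg)
    linarith
  refine ⟨hpos, ?_, ?_⟩
  · have e : incl j i = n₀ j / N j * (N j / n₀ j * incl j i) := by field_simp
    rw [e]
    calc n₀ j / N j * (N j / n₀ j * incl j i) ≤ n₀ j / N j * C₂ := by gcongr
      _ ≤ 1 := by linarith
  · rw [inv_le_comm₀ hpos (by positivity), inv_div, div_le_iff₀ hN']
    calc C₁ * n₀ j ≤ N j / n₀ j * incl j i * n₀ j := by gcongr
      _ = incl j i * N j := by field_simp

theorem tendsto_weight (h : RegularSamples p Sp C₁ C₂ N n₀ A incl y) (hp : ∑ a, p a = 1) :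
    Tendsto (fun j => (∑ i ∈ A j, (incl j i)⁻¹) / N j) atTop (𝓝 1) := by
  have := tendsto_finsetSum Finset.univ fun a _ => h.mean a
  rw [hp] at this
  refine this.congr fun j => ?_
  rw [← Finset.sum_div, sum_cell_ite (A j) (fun i => (incl j i)⁻¹) (y j)]

theorem tendsto_sampleProp (h : RegularSamples p Sp C₁ C₂ N n₀ A incl y) (hC₁ : 0 < C₁)
    (hp : ∑ a, p a = 1) (a : Cell r c) :
    Tendsto (fun j => sampleProp (A j) (incl j) (y j) a) atTop (𝓝 (p a)) := by
  have := (h.mean a).div (h.tendsto_weight hp) one_ne_zero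
  rw [div_one] at this
  refine this.congr' ?_
  filter_upwards [h.eventually_pos hC₁] with j hj
  have hN : (N j : ℝ) ≠ 0 := by exact_mod_cast hj.2.1.ne'
  simp only [sampleProp, cellProp, Pi.div_apply]
  rw [div_div_div_cancel_right₀ hN]

theorem tendsto_card (h : RegularSamples p Sp C₁ C₂ N n₀ A incl y) :
    Tendsto (fun j => ((A j).card : ℝ)) atTop atTop := by
  refine (h.card.pos_mul_atTop one_pos h.size).congr' ?_
  filter_upwards [h.size.eventually_gt_atTop 0] with j hj
  field_simp

end RegularSamples

/-- The bootstrap total `N⁻¹ ∑ w_i m_i`. -/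
noncomputable def bootScale {ι : Type*} (N : ℕ) (A : Finset ι) (incl : ι → ℝ) (m : ι → ℕ) : ℝ :=
  (∑ i ∈ A, (incl i)⁻¹ * m i) / N

/-- The normalized bootstrap score `√n N⁻¹ ∑ w_i m_i (1{y_i = a} - q_a)` of the free cells, with
`q` the sample proportions. -/
noncomputable def bootScore {ι : Type*} (N : ℕ) (A : Finset ι) (incl : ι → ℝ) (y : ι → Cell r c)
    (m : ι → ℕ) : EuclideanSpace ℝ (FreeCell r c) :=
  WithLp.toLp 2 fun a => √A.card / N * ∑ i ∈ A, (incl i)⁻¹ * m i *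
    ((if y i = a.1 then 1 else 0) - sampleProp A incl y a.1)

/-- Bootstrap total and score as a single vector. -/
noncomputable def bootVec {ι : Type*} (N : ℕ) (A : Finset ι) (incl : ι → ℝ) (y : ι → Cell r c)
    (m : ι → ℕ) : WithLp 2 (ℝ × EuclideanSpace ℝ (FreeCell r c)) :=
  WithLp.toLp 2 (bootScale N A incl m, bootScore N A incl y m)

/-- The contribution of one retained copy of unit `i` to the linear form `t` of `bootVec`. -/
noncomputable def bootCoeff {ι : Type*} (N : ℕ) (A : Finset ι) (incl : ι → ℝ) (y : ι → Cell r c)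
    (t : WithLp 2 (ℝ × EuclideanSpace ℝ (FreeCell r c))) (i : ι) : ℝ :=
  (incl i)⁻¹ * (t.fst / N + √A.card / N *
    ∑ a : FreeCell r c, t.snd a * ((if y i = a.1 then 1 else 0) - sampleProp A incl y a.1))

theorem inner_bootVec {ι : Type*} (N : ℕ) (A : Finset ι) (incl : ι → ℝ) (y : ι → Cell r c)
    (m : ι → ℕ) (t : WithLp 2 (ℝ × EuclideanSpace ℝ (FreeCell r c))) :
    inner ℝ (bootVec N A incl y m) t = ∑ i ∈ A, m i * bootCoeff N A incl y t i := by
  simp only [WithLp.prod_inner_apply, WithLp.fst, WithLp.snd, bootVec, bootScale, bootScore, bootCoeff,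
    PiLp.inner_apply, RCLike.inner_apply, conj_trivial, mul_add,
    Finset.sum_add_distrib, Finset.mul_sum, Finset.sum_div]
  congr 1
  · exact Finset.sum_congr rfl fun i _ => by ring
  · rw [Finset.sum_comm]
    exact Finset.sum_congr rfl fun i _ => Finset.sum_congr rfl fun a _ => by ring

/-- The linear form `t` is `∑ m_i x_i` with `x_i` the `bootCoeff`, so its character is the
generating function at `z_i = exp(i x_i)`. -/
theorem charFun_map_bootVec {ι : Type*} [Fintype ι] [DecidableEq ι] {A : Finset ι}
    {incl : ι → ℝ} (N : ℕ) (hA : A.Nonempty) (h0 : ∀ i ∈ A, 0 < incl i)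
    (h1 : ∀ i ∈ A, incl i ≤ 1) (y : ι → Cell r c)
    (t : WithLp 2 (ℝ × EuclideanSpace ℝ (FreeCell r c))) :
    charFun ((bootLaw N A incl).map (bootVec N A incl y)) t =
      (1 + ((∑ i ∈ A, (incl i)⁻¹ : ℝ) : ℂ)⁻¹ *
        ∑ i ∈ A, (Complex.exp (bootCoeff N A incl y t i * Complex.I) - 1)) ^ N := by
  rw [← integral_prod_pow_bootLaw N hA h0 h1, charFun_apply, integral_map]
  · refine integral_congr_ae (Eventually.of_forall fun m => ?_)
    simp only [inner_bootVec]
    push_cast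
    rw [Finset.sum_mul, Complex.exp_sum]
    refine Finset.prod_congr rfl fun i _ => ?_
    rw [← Complex.exp_nat_mul, mul_assoc]
  · exact Measurable.of_discrete.aemeasurable
  · exact Continuous.aestronglyMeasurable (by fun_prop)

/-- The weak limit of the law of `bootVec`. -/
noncomputable def bootLimit (Sp : Matrix (FreeCell r c) (FreeCell r c) ℝ) :
    Measure (WithLp 2 (ℝ × EuclideanSpace ℝ (FreeCell r c))) :=
  ((Measure.dirac 1).prod (multivariateGaussian 0 Sp)).map (WithLp.toLp 2)

instance (Sp : Matrix (FreeCell r c) (FreeCell r c) ℝ) : IsProbabilityMeasure (bootLimit Sp) :=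
  Measure.isProbabilityMeasure_map (by fun_prop)

theorem charFun_bootLimit {Sp : Matrix (FreeCell r c) (FreeCell r c) ℝ} (hSp : Sp.PosSemidef)
    (t : WithLp 2 (ℝ × EuclideanSpace ℝ (FreeCell r c))) :
    charFun (bootLimit Sp) t =
      Complex.exp (t.fst * Complex.I - ((∑ a, ∑ b, t.snd a * t.snd b * Sp a b : ℝ) : ℂ) / 2) := by
  rw [bootLimit, charFun_prod, charFun_multivariateGaussian hSp, charFun_dirac, ← Complex.exp_add]
  congr 1
  simp only [RCLike.inner_apply, conj_trivial, dotProduct, WithLp.fst, WithLp.snd, Matrix.mulVec, inner_zero_right,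
    Complex.ofReal_zero, zero_mul, zero_sub, Finset.mul_sum]
  rw [sub_eq_add_neg]
  congr 2
  · simp
  · congr 2
    exact Finset.sum_congr rfl fun a _ => Finset.sum_congr rfl fun b _ => by ring

/-- The sample proportions solve the weighted score equations exactly, so the score drops out of the
mean and only the total contributes. -/
theorem sum_bootCoeff {ι : Type*} {N : ℕ} {A : Finset ι} {incl : ι → ℝ} (y : ι → Cell r c)
    (t : WithLp 2 (ℝ × EuclideanSpace ℝ (FreeCell r c))) (hN : (N : ℝ) ≠ 0)
    (hW : ∑ i ∈ A, (incl i)⁻¹ ≠ 0) :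
    N / (∑ i ∈ A, (incl i)⁻¹) * ∑ i ∈ A, bootCoeff N A incl y t i = t.fst := by
  have hz : ∀ a : FreeCell r c, ∑ i ∈ A, (incl i)⁻¹ *
      ((if y i = a.1 then 1 else 0) - sampleProp A incl y a.1) = 0 := fun a => by
    simp only [mul_sub, Finset.sum_sub_distrib, ← Finset.sum_mul, sampleProp, cellProp]
    rw [mul_div_cancel₀ _ hW]
    simp
  have hz' : ∑ i ∈ A, (incl i)⁻¹ * ∑ a : FreeCell r c,
      t.snd a * ((if y i = a.1 then 1 else 0) - sampleProp A incl y a.1) = 0 := by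
    simp only [Finset.mul_sum]
    rw [Finset.sum_comm]
    refine Finset.sum_eq_zero fun a _ => ?_
    trans t.snd a * ∑ i ∈ A, (incl i)⁻¹ * ((if y i = a.1 then 1 else 0) - sampleProp A incl y a.1)
    · rw [Finset.mul_sum]
      exact Finset.sum_congr rfl fun i _ => by ring
    · rw [hz a, mul_zero]
  have : ∑ i ∈ A, bootCoeff N A incl y t i = (∑ i ∈ A, (incl i)⁻¹) * (t.fst / N) +
      √A.card / N * ∑ i ∈ A, (incl i)⁻¹ * ∑ a : FreeCell r c,
        t.snd a * ((if y i = a.1 then 1 else 0) - sampleProp A incl y a.1) := by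
    rw [Finset.sum_mul, Finset.mul_sum, ← Finset.sum_add_distrib]
    exact Finset.sum_congr rfl fun i _ => by unfold bootCoeff; ring
  rw [this, hz', mul_zero, add_zero, ← mul_assoc, div_mul_cancel₀ _ hW, mul_div_cancel₀ _ hN]

namespace RegularSamples

variable {p : Cell r c → ℝ} {Sp : Matrix (FreeCell r c) (FreeCell r c) ℝ} {C₁ C₂ : ℝ}
  {N : ℕ → ℕ} {n₀ : ℕ → ℝ} {A : ∀ j, Finset (Fin (N j))} {incl : ∀ j, Fin (N j) → ℝ}
  {y : ∀ j, Fin (N j) → Cell r c}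

/-- The weights are at most `N / (C₁ n₀)` and eventually `|A| ≤ 2 n₀`. This boundedness is what
makes recentring from the sample proportions to `p` harmless. -/
theorem eventually_weight_sq_le (h : RegularSamples p Sp C₁ C₂ N n₀ A incl y) (hC₁ : 0 < C₁) :
    ∀ᶠ j in atTop, n₀ j / (N j : ℝ) ^ 2 * ∑ i ∈ A j, (incl j i)⁻¹ ^ 2 ≤ 2 / C₁ ^ 2 := by
  filter_upwards [h.eventually_pos hC₁, h.card.eventually_lt_const (show (1 : ℝ) < 2 by norm_num)]
    with j ⟨hn, hN, _, hi⟩ hc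
  have hN' : (0 : ℝ) < N j := by exact_mod_cast hN
  calc n₀ j / (N j : ℝ) ^ 2 * ∑ i ∈ A j, (incl j i)⁻¹ ^ 2
      ≤ n₀ j / (N j : ℝ) ^ 2 * ∑ i ∈ A j, (N j / (C₁ * n₀ j)) ^ 2 := by
        gcongr with i
        · exact inv_nonneg.2 (hi i).1.le
        · exact (hi i).2.2
    _ = (A j).card / n₀ j / C₁ ^ 2 := by
        rw [Finset.sum_const, nsmul_eq_mul]
        field_simp
    _ ≤ 2 / C₁ ^ 2 := by gcongr

theorem tendsto_quadratic (h : RegularSamples p Sp C₁ C₂ N n₀ A incl y) (t : FreeCell r c → ℝ) :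
    Tendsto (fun j => n₀ j / (N j : ℝ) ^ 2 * ∑ i ∈ A j, (incl j i)⁻¹ ^ 2 *
      (∑ a : FreeCell r c, t a * ((if y j i = a.1 then 1 else 0) - p a.1)) ^ 2) atTop
      (𝓝 (∑ a, ∑ b, t a * t b * Sp a b)) := by
  have := tendsto_finsetSum Finset.univ fun a _ => tendsto_finsetSum Finset.univ fun b _ =>
    (h.second a b).const_mul (t a * t b)
  refine this.congr fun j => ?_
  have hexp : ∀ i, (incl j i)⁻¹ ^ 2 *
      (∑ a : FreeCell r c, t a * ((if y j i = a.1 then 1 else 0) - p a.1)) ^ 2 =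
      ∑ a : FreeCell r c, ∑ b : FreeCell r c, t a * t b * ((incl j i)⁻¹ ^ 2 *
        ((if y j i = a.1 then 1 else 0) - p a.1) * ((if y j i = b.1 then 1 else 0) - p b.1)) :=
    fun i => by
      rw [sq (∑ a : FreeCell r c, _), Finset.sum_mul_sum, Finset.mul_sum]
      refine Finset.sum_congr rfl fun a _ => ?_
      rw [Finset.mul_sum]
      exact Finset.sum_congr rfl fun b _ => by ring
  simp only [hexp]
  symm
  rw [Finset.sum_comm, Finset.mul_sum]
  refine Finset.sum_congr rfl fun a _ => ?_
  rw [Finset.sum_comm, Finset.mul_sum]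
  refine Finset.sum_congr rfl fun b _ => ?_
  rw [← Finset.mul_sum]
  ring

/-- The bootstrap centres at the sample proportions, the second moments of `RegularSamples` at `p`.
The coefficient is `(√n / N) w_i (cc (y_i) + τ)` with a null `τ`, and expanding the square leaves
`tendsto_quadratic` plus terms in `τ` and `τ²`. -/
theorem tendsto_sum_bootCoeff_sq (h : RegularSamples p Sp C₁ C₂ N n₀ A incl y) (hC₁ : 0 < C₁)
    (hp : ∑ a, p a = 1) (t : WithLp 2 (ℝ × EuclideanSpace ℝ (FreeCell r c))) :
    Tendsto (fun j => N j / (∑ i ∈ A j, (incl j i)⁻¹) *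
      ∑ i ∈ A j, bootCoeff (N j) (A j) (incl j) (y j) t i ^ 2) atTop
      (𝓝 (∑ a, ∑ b, t.snd a * t.snd b * Sp a b)) := by
  set q : ∀ _ : ℕ, Cell r c → ℝ := fun j => sampleProp (A j) (incl j) (y j)
  set cc : Cell r c → ℝ := fun k => ∑ a : FreeCell r c, t.snd a * ((if k = a.1 then 1 else 0) - p a.1)
  -- `τ` collects everything that does not depend on the unit: the contribution of the total and the
  -- recentring shift.
  set τ : ℕ → ℝ := fun j => t.fst / √(A j).card - ∑ a : FreeCell r c, t.snd a * (q j a.1 - p a.1)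
  have hτ : Tendsto τ atTop (𝓝 0) := by
    have h1 : Tendsto (fun j => t.fst / √(A j).card) atTop (𝓝 0) :=
      (Real.tendsto_sqrt_atTop.comp h.tendsto_card).const_div_atTop _
    have h2 : Tendsto (fun j => ∑ a : FreeCell r c, t.snd a * (q j a.1 - p a.1)) atTop (𝓝 0) := by
      have := tendsto_finsetSum Finset.univ fun (a : FreeCell r c) _ =>
        ((h.tendsto_sampleProp hC₁ hp a.1).sub_const (p a.1)).const_mul (t.snd a)
      simpa using this
    simpa using h1.sub h2
  obtain ⟨T, hT⟩ : ∃ T, ∀ k, |cc k| ≤ T :=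
    ⟨∑ k, |cc k|, fun k => Finset.single_le_sum (f := fun k => |cc k|)
      (fun _ _ => abs_nonneg _) (Finset.mem_univ k)⟩
  set B : ℕ → ℝ := fun j => n₀ j / (N j : ℝ) ^ 2 * ∑ i ∈ A j, (incl j i)⁻¹ ^ 2
  set R : ℕ → ℝ := fun j => n₀ j / (N j : ℝ) ^ 2 * ∑ i ∈ A j, (incl j i)⁻¹ ^ 2 * cc (y j i)
  have hB0 : ∀ᶠ j in atTop, 0 ≤ B j := by
    filter_upwards [h.size.eventually_ge_atTop 0] with j hj
    exact mul_nonneg (by positivity) (Finset.sum_nonneg fun i _ => sq_nonneg _)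
  have hBle := h.eventually_weight_sq_le hC₁
  have hRB : ∀ᶠ j in atTop, |R j| ≤ T * B j := by
    filter_upwards [h.size.eventually_ge_atTop 0] with j hj
    simp only [R, B]
    rw [abs_mul, abs_of_nonneg (by positivity), mul_left_comm]
    refine mul_le_mul_of_nonneg_left ?_ (by positivity)
    rw [Finset.mul_sum]
    refine (Finset.abs_sum_le_sum_abs _ _).trans (Finset.sum_le_sum fun i _ => ?_)
    rw [abs_mul, abs_of_nonneg (sq_nonneg _), mul_comm]
    exact mul_le_mul_of_nonneg_right (hT _) (sq_nonneg _)
  have hτB : Tendsto (fun j => τ j ^ 2 * B j) atTop (𝓝 0) := by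
    have hlim : Tendsto (fun j => τ j ^ 2 * (2 / C₁ ^ 2)) atTop (𝓝 0) := by
      simpa using (hτ.pow 2).mul_const (2 / C₁ ^ 2)
    refine squeeze_zero' ?_ ?_ hlim
    · filter_upwards [hB0] with j hj using mul_nonneg (sq_nonneg _) hj
    · filter_upwards [hBle] with j hj using mul_le_mul_of_nonneg_left hj (sq_nonneg _)
  have hτR : Tendsto (fun j => 2 * τ j * R j) atTop (𝓝 0) := by
    have hlim : Tendsto (fun j => 2 * |τ j| * (T * (2 / C₁ ^ 2))) atTop (𝓝 0) := by
      simpa using (hτ.abs.const_mul 2).mul_const (T * (2 / C₁ ^ 2))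
    have hT0 : 0 ≤ T := (abs_nonneg _).trans (hT (0, 0))
    refine squeeze_zero_norm' ?_ hlim
    filter_upwards [hBle, hRB] with j h1 h2
    rw [Real.norm_eq_abs, abs_mul, abs_mul, abs_two]
    refine mul_le_mul_of_nonneg_left (h2.trans ?_) (by positivity)
    exact mul_le_mul_of_nonneg_left h1 hT0
  have hratio : Tendsto (fun j => (N j : ℝ) / (∑ i ∈ A j, (incl j i)⁻¹)) atTop (𝓝 1) := by
    simpa using (h.tendsto_weight hp).inv₀ one_ne_zero
  have hfin := (hratio.mul h.card).mul (((h.tendsto_quadratic t.snd).add hτR).add hτB)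
  simp only [one_mul, add_zero] at hfin
  refine hfin.congr' ?_
  filter_upwards [h.eventually_pos hC₁] with j ⟨hn, hN, hA, hi⟩
  have hN' : (0 : ℝ) < N j := by exact_mod_cast hN
  have hc : (0 : ℝ) < (A j).card := by exact_mod_cast hA.card_pos
  have hs : 0 < √((A j).card : ℝ) := Real.sqrt_pos.2 hc
  have hcoeff : ∀ i, bootCoeff (N j) (A j) (incl j) (y j) t i ^ 2 =
      (A j).card / (N j : ℝ) ^ 2 * ((incl j i)⁻¹ ^ 2 * cc (y j i) ^ 2 +
        2 * τ j * ((incl j i)⁻¹ ^ 2 * cc (y j i)) + τ j ^ 2 * (incl j i)⁻¹ ^ 2) := fun i => by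
    have e1 : ∑ a : FreeCell r c, t.snd a * ((if y j i = a.1 then 1 else 0) -
        sampleProp (A j) (incl j) (y j) a.1) =
        cc (y j i) - ∑ a : FreeCell r c, t.snd a * (q j a.1 - p a.1) := by
      simp only [cc, q, ← Finset.sum_sub_distrib]
      exact Finset.sum_congr rfl fun a _ => by ring
    have e2 : bootCoeff (N j) (A j) (incl j) (y j) t i =
        √(A j).card / N j * ((incl j i)⁻¹ * (cc (y j i) + τ j)) := by
      simp only [bootCoeff, e1, τ]
      field_simp
      ring
    rw [e2, mul_pow, div_pow, Real.sq_sqrt hc.le]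
    ring
  simp only [hcoeff, ← Finset.mul_sum, Finset.sum_add_distrib]
  simp only [B, R, cc]
  field_simp

theorem tendsto_charFun (h : RegularSamples p Sp C₁ C₂ N n₀ A incl y) (hC₁ : 0 < C₁)
    (hp : ∑ a, p a = 1) (t : WithLp 2 (ℝ × EuclideanSpace ℝ (FreeCell r c))) :
    Tendsto (fun j => charFun ((bootLaw (N j) (A j) (incl j)).map
      (bootVec (N j) (A j) (incl j) (y j))) t) atTop
      (𝓝 (Complex.exp (t.fst * Complex.I -
        ((∑ a, ∑ b, t.snd a * t.snd b * Sp a b : ℝ) : ℂ) / 2))) := by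
  have hW : ∀ᶠ j in atTop, 0 < ∑ i ∈ A j, (incl j i)⁻¹ := by
    filter_upwards [h.eventually_pos hC₁] with j ⟨_, _, hA, hi⟩
    exact Finset.sum_pos (fun i _ => inv_pos.2 (hi i).1) hA
  -- The population contains the sample, whose size tends to infinity.
  have hNtop : Tendsto N atTop atTop := by
    rw [← tendsto_natCast_atTop_iff (R := ℝ)]
    have hcard : ∀ j, ((A j).card : ℝ) ≤ N j := fun j => by
      exact_mod_cast (Finset.card_le_univ (A j)).trans_eq (Fintype.card_fin _)
    exact tendsto_atTop_mono hcard h.tendsto_card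
  set K : ℝ := ∑ a : FreeCell r c, |t.snd a|
  -- A uniform bound for the coefficients, of order `n₀^{-1/2}`: the weights are at most `N / (C₁
  -- n₀)`, and `K` bounds the centred indicator sum because each centred indicator lies in `[-1,
  -- 1]`.
  have hb : Tendsto (fun j => |t.fst| / (C₁ * n₀ j) +
      K / C₁ * √((A j).card / n₀ j) / √(n₀ j)) atTop (𝓝 0) := by
    have h1 : Tendsto (fun j => |t.fst| / (C₁ * n₀ j)) atTop (𝓝 0) :=
      (h.size.const_mul_atTop hC₁).const_div_atTop _
    have h2 : Tendsto (fun j => K / C₁ * √((A j).card / n₀ j)) atTop (𝓝 (K / C₁ * √1)) :=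
      ((Real.continuous_sqrt.tendsto 1).comp h.card).const_mul _
    have h3 := h2.div_atTop (Real.tendsto_sqrt_atTop.comp h.size)
    simpa using h1.add h3
  have hlin : Tendsto (fun j => N j / (∑ i ∈ A j, (incl j i)⁻¹) *
      ∑ i ∈ A j, bootCoeff (N j) (A j) (incl j) (y j) t i) atTop (𝓝 t.fst) := by
    refine tendsto_const_nhds.congr' ?_
    filter_upwards [h.eventually_pos hC₁, hW] with j hj hWj
    exact (sum_bootCoeff (y j) t (by exact_mod_cast hj.2.1.ne') hWj.ne').symm
  have hsum := tendsto_sum_cexp_sub_one (s := A)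
    (x := fun j => bootCoeff (N j) (A j) (incl j) (y j) t) ?_ hb ?_ hlin
    (h.tendsto_sum_bootCoeff_sq hC₁ hp t)
  · have hpow := tendsto_one_add_pow_cexp (g := fun j =>
      ((∑ i ∈ A j, (incl j i)⁻¹ : ℝ) : ℂ)⁻¹ *
        ∑ i ∈ A j, (Complex.exp (bootCoeff (N j) (A j) (incl j) (y j) t i * Complex.I) - 1))
      hNtop (hsum.congr fun j => by push_cast; ring)
    refine hpow.congr' ?_
    filter_upwards [h.eventually_pos hC₁] with j ⟨_, _, hA, hi⟩
    exact (charFun_map_bootVec (N j) hA (fun i _ => (hi i).1) (fun i _ => (hi i).2.1) (y j) t).symm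
  · filter_upwards [hW] with j hj
    positivity
  · filter_upwards [h.eventually_pos hC₁] with j ⟨hn, hN, hA, hi⟩ i _
    have hN' : (0 : ℝ) < N j := by exact_mod_cast hN
    have hin : |∑ a : FreeCell r c, t.snd a * ((if y j i = a.1 then 1 else 0) -
        sampleProp (A j) (incl j) (y j) a.1)| ≤ K := by
      refine (Finset.abs_sum_le_sum_abs _ _).trans (Finset.sum_le_sum fun a _ => ?_)
      rw [abs_mul]
      refine mul_le_of_le_one_right (abs_nonneg _) ?_
      obtain ⟨hq0, hq1⟩ := cellProp_mem_Icc (A := A j) (y j)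
        (fun i _ => inv_nonneg.2 (hi i).1.le) a.1
      rw [sampleProp, abs_le]
      split_ifs <;> constructor <;> linarith
    have hsq : √((A j).card : ℝ) = √((A j).card / n₀ j) * √(n₀ j) := by
      rw [← Real.sqrt_mul (by positivity)]
      congr 1
      field_simp
    have hs : √(n₀ j) ^ 2 = n₀ j := Real.sq_sqrt hn.le
    have hs0 : 0 < √(n₀ j) := Real.sqrt_pos.2 hn
    calc |bootCoeff (N j) (A j) (incl j) (y j) t i|
        ≤ N j / (C₁ * n₀ j) * (|t.fst| / N j + √(A j).card / N j * K) := by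
          rw [bootCoeff, abs_mul, abs_of_pos (inv_pos.2 (hi i).1)]
          refine mul_le_mul (hi i).2.2 ((abs_add_le _ _).trans (add_le_add ?_ ?_))
            (abs_nonneg _) (by positivity)
          · rw [abs_div, Nat.abs_cast]
          · rw [abs_mul, abs_of_nonneg (by positivity)]
            exact mul_le_mul_of_nonneg_left hin (by positivity)
      _ = |t.fst| / (C₁ * n₀ j) + K / C₁ * √((A j).card / n₀ j) / √(n₀ j) := by
          rw [hsq, ← hs, Real.sqrt_sq hs0.le]
          field_simp

/-- The joint weak limit of the bootstrap total and the bootstrap score. -/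
theorem exists_tendsto_bootVec (h : RegularSamples p Sp C₁ C₂ N n₀ A incl y) (hC₁ : 0 < C₁)
    (hp : ∑ a, p a = 1) (hSp : Sp.PosSemidef) :
    ∃ μ : ℕ → ProbabilityMeasure (WithLp 2 (ℝ × EuclideanSpace ℝ (FreeCell r c))),
      (∀ᶠ j in atTop, (μ j : Measure _) =
        (bootLaw (N j) (A j) (incl j)).map (bootVec (N j) (A j) (incl j) (y j))) ∧
      Tendsto μ atTop (𝓝 ⟨bootLimit Sp, inferInstance⟩) := by
  classical
  set L : ∀ _ : ℕ, Measure (WithLp 2 (ℝ × EuclideanSpace ℝ (FreeCell r c))) := fun j =>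
    (bootLaw (N j) (A j) (incl j)).map (bootVec (N j) (A j) (incl j) (y j))
  -- The bootstrap law is only known to be a probability measure eventually; the Dirac mass is a
  -- dummy value for the other indices.
  set μ : ℕ → ProbabilityMeasure (WithLp 2 (ℝ × EuclideanSpace ℝ (FreeCell r c))) := fun j =>
    if hj : IsProbabilityMeasure (L j) then ⟨L j, hj⟩ else ⟨Measure.dirac 0, inferInstance⟩
  have hμ : ∀ᶠ j in atTop, (μ j : Measure _) = L j := by
    filter_upwards [h.eventually_pos hC₁] with j ⟨_, _, hA, hi⟩
    have := isProbabilityMeasure_bootLaw (N j) hA (fun i _ => (hi i).1) (fun i _ => (hi i).2.1)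
    have hL : IsProbabilityMeasure (L j) :=
      Measure.isProbabilityMeasure_map Measurable.of_discrete.aemeasurable
    rw [show μ j = ⟨L j, hL⟩ from dif_pos hL]
    rfl
  refine ⟨μ, hμ, ProbabilityMeasure.tendsto_of_tendsto_charFun fun t => ?_⟩
  change Tendsto _ _ (𝓝 (charFun (bootLimit Sp) t))
  rw [charFun_bootLimit hSp]
  refine (h.tendsto_charFun hC₁ hp t).congr' ?_
  filter_upwards [hμ] with j hj
  rw [hj]

end RegularSamples

end BootstrapLimit

/-! ### Expansion of the two statistics at scale `n^{-1/2}`. -/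

section Statistics

variable {r c : ℕ}

/-- The vector of all cell increments, summing to zero, with given free coordinates. -/
def tangent (s : FreeCell r c → ℝ) : Cell r c → ℝ := fun a =>
  if h : a ≠ (Fin.last r, Fin.last c) then s ⟨a, h⟩ else -∑ b, s b

theorem tangent_free (s : FreeCell r c → ℝ) (a : FreeCell r c) : tangent s a.1 = s a :=
  dif_pos a.2

theorem sum_eq_last_add_sum_free (f : Cell r c → ℝ) :
    ∑ a, f a = f (Fin.last r, Fin.last c) + ∑ a : FreeCell r c, f a.1 :=
  Fintype.sum_eq_add_sum_subtype_ne f _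

theorem sum_tangent (s : FreeCell r c → ℝ) : ∑ a, tangent s a = 0 := by
  rw [sum_eq_last_add_sum_free]
  simp only [tangent_free]
  simp [tangent]

theorem eq_tangent {u : Cell r c → ℝ} (hu : ∑ a, u a = 0) : u = tangent fun a => u a.1 := by
  funext a
  by_cases h : a ≠ (Fin.last r, Fin.last c)
  · exact (tangent_free (fun a => u a.1) ⟨a, h⟩).symm
  · rw [tangent, dif_neg h, not_not.1 h]
    rw [sum_eq_last_add_sum_free] at hu
    linarith

theorem continuous_tangent : Continuous (tangent : (FreeCell r c → ℝ) → Cell r c → ℝ) := by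
  refine continuous_pi fun a => ?_
  unfold tangent
  split_ifs <;> fun_prop

/-- The directional derivative of `indepDiff` at `q`. -/
def indepDeriv (q u : Cell r c → ℝ) (a : Cell r c) : ℝ :=
  u a - (rowMargin u a.1 * colMargin q a.2 + rowMargin q a.1 * colMargin u a.2)

/-- The limiting quadratic form of the two statistics. -/
noncomputable def chiForm (p u : Cell r c → ℝ) : ℝ :=
  ∑ a, indepDeriv p u a ^ 2 / (rowMargin p a.1 * colMargin p a.2)

theorem rowMargin_add_smul (q u : Cell r c → ℝ) (η : ℝ) (i : Fin (r + 1)) :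
    rowMargin (q + η • u) i = rowMargin q i + η * rowMargin u i := by
  simp [rowMargin, Finset.sum_add_distrib, Finset.mul_sum]

theorem colMargin_add_smul (q u : Cell r c → ℝ) (η : ℝ) (j : Fin (c + 1)) :
    colMargin (q + η • u) j = colMargin q j + η * colMargin u j := by
  simp [colMargin, Finset.sum_add_distrib, Finset.mul_sum]

theorem continuous_rowMargin (i : Fin (r + 1)) :
    Continuous fun q : Cell r c → ℝ => rowMargin q i := by
  unfold rowMargin; fun_prop

theorem continuous_colMargin (j : Fin (c + 1)) :
    Continuous fun q : Cell r c → ℝ => colMargin q j := by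
  unfold colMargin; fun_prop

theorem rowMargin_pos {p : Cell r c → ℝ} (hp : ∀ a, 0 < p a) (i : Fin (r + 1)) :
    0 < rowMargin p i := Finset.sum_pos (fun _ _ => hp _) Finset.univ_nonempty

theorem colMargin_pos {p : Cell r c → ℝ} (hp : ∀ a, 0 < p a) (j : Fin (c + 1)) :
    0 < colMargin p j := Finset.sum_pos (fun _ _ => hp _) Finset.univ_nonempty

theorem measurable_pearsonStat (n : ℝ) (q : Cell r c → ℝ) : Measurable (pearsonStat n q) := by
  have h1 := fun i => (continuous_rowMargin (r := r) (c := c) i).measurable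
  have h2 := fun j => (continuous_colMargin (r := r) (c := c) j).measurable
  unfold pearsonStat indepDiff
  fun_prop

theorem measurable_lrStat (n : ℝ) (q : Cell r c → ℝ) : Measurable (lrStat n q) := by
  have h1 := fun i => (continuous_rowMargin (r := r) (c := c) i).measurable
  have h2 := fun j => (continuous_colMargin (r := r) (c := c) j).measurable
  unfold lrStat
  fun_prop

variable {κ : Type*} {l : Filter κ} {n : κ → ℝ} {q u : κ → Cell r c → ℝ} {p u₀ : Cell r c → ℝ}

/-- `indepDiff` is quadratic, so its increment is exactly `n^{-1/2}` times its derivative minus a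
product of margins of order `1 / n`; the prefactor `n` cancels the squared scale. The filter is
arbitrary so that base point and direction may vary together, as continuous convergence requires. -/
theorem tendsto_pearsonStat (hp : ∀ a, 0 < p a) (hn : Tendsto n l atTop)
    (hq : Tendsto q l (𝓝 p)) (hu : Tendsto u l (𝓝 u₀)) :
    Tendsto (fun k => pearsonStat (n k) (q k) (q k + (√(n k))⁻¹ • u k)) l
      (𝓝 (chiForm p u₀)) := by
  have hη : Tendsto (fun k => (√(n k))⁻¹) l (𝓝 0) :=
    tendsto_inv_atTop_zero.comp (Real.tendsto_sqrt_atTop.comp hn)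
  have hrq := fun i => ((continuous_rowMargin i).tendsto p).comp hq
  have hcq := fun i => ((continuous_colMargin i).tendsto p).comp hq
  have hru := fun i => ((continuous_rowMargin i).tendsto u₀).comp hu
  have hcu := fun i => ((continuous_colMargin i).tendsto u₀).comp hu
  have hlim : Tendsto (fun k => ∑ a : Cell r c, (indepDeriv (q k) (u k) a -
      (√(n k))⁻¹ * (rowMargin (u k) a.1 * colMargin (u k) a.2)) ^ 2 /
        (rowMargin (q k) a.1 * colMargin (q k) a.2)) l (𝓝 (chiForm p u₀)) := by
    refine tendsto_finsetSum _ fun a _ => ?_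
    have h1 : Tendsto (fun k => indepDeriv (q k) (u k) a) l (𝓝 (indepDeriv p u₀ a)) :=
      ((tendsto_pi_nhds.1 hu) a).sub (((hru a.1).mul (hcq a.2)).add ((hrq a.1).mul (hcu a.2)))
    have h2 := h1.sub (hη.mul ((hru a.1).mul (hcu a.2)))
    rw [zero_mul, sub_zero] at h2
    exact (h2.pow 2).div ((hrq a.1).mul (hcq a.2))
      (mul_pos (rowMargin_pos hp _) (colMargin_pos hp _)).ne'
  refine hlim.congr' ?_
  filter_upwards [hn.eventually_gt_atTop 0] with k hk
  have hs : √(n k) ^ 2 = n k := Real.sq_sqrt hk.le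
  have hs0 : √(n k) ≠ 0 := (Real.sqrt_pos.2 hk).ne'
  rw [pearsonStat, Finset.mul_sum]
  refine Finset.sum_congr rfl fun a _ => ?_
  rw [← mul_div_assoc]
  congr 1
  have e : indepDiff (q k + (√(n k))⁻¹ • u k) a - indepDiff (q k) a =
      (√(n k))⁻¹ * (indepDeriv (q k) (u k) a -
      (√(n k))⁻¹ * (rowMargin (u k) a.1 * colMargin (u k) a.2)) := by
    simp only [indepDiff, indepDeriv, rowMargin_add_smul, colMargin_add_smul, Pi.add_apply,
      Pi.smul_apply, smul_eq_mul]
    ring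
  rw [e, mul_pow _ (_ - _), inv_pow, hs, mul_inv_cancel_left₀ hk.ne']

theorem abs_mul_log_sub_le {v : ℝ} (hv : |v - 1| ≤ 1 / 2) :
    |v * Real.log v - v + 1 - (v - 1) ^ 2 / 2| ≤ 4 * |v - 1| ^ 3 := by
  have hx1 : |1 - v| ≤ 1 / 2 := by rwa [abs_sub_comm]
  have h := Real.abs_log_sub_add_sum_range_le (x := 1 - v) (by linarith) 2
  simp only [Finset.sum_range_succ, Finset.sum_range_zero, sub_sub_cancel] at h
  norm_num at h
  set R := 1 - v + (1 - v) ^ 2 / 2 + Real.log v with hR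
  have hR' : |R| ≤ 2 * |1 - v| ^ 3 := by
    refine h.trans ?_
    rw [div_le_iff₀ (by linarith)]
    have : 0 ≤ |1 - v| ^ 3 := by positivity
    nlinarith
  -- With `|v| ≤ 3/2` and `|R| ≤ 2 |1 - v|³` the two parts add up to `7/2`, rounded up to 4.
  have e : v * Real.log v - v + 1 - (v - 1) ^ 2 / 2 = (1 - v) ^ 3 / 2 + v * R := by
    rw [hR]; ring
  have hv2 : |v| ≤ 3 / 2 := by
    have := abs_sub_abs_le_abs_sub v 1
    rw [abs_one] at this
    linarith
  rw [e, abs_sub_comm v 1]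
  calc |(1 - v) ^ 3 / 2 + v * R| ≤ |(1 - v) ^ 3 / 2| + |v * R| := abs_add_le _ _
    _ ≤ |1 - v| ^ 3 / 2 + 3 / 2 * (2 * |1 - v| ^ 3) := by
        rw [abs_div, abs_pow, abs_mul, abs_two]
        gcongr
    _ ≤ 4 * |1 - v| ^ 3 := by
        have : 0 ≤ |1 - v| ^ 3 := by positivity
        linarith

/-- Second order expansion of a likelihood ratio term. -/
theorem tendsto_lr_term {X Y : κ → ℝ} {y₀ d : ℝ} (hy₀ : 0 < y₀) (hn : Tendsto n l atTop)
    (hY : Tendsto Y l (𝓝 y₀)) (hd : Tendsto (fun k => √(n k) * (X k - Y k)) l (𝓝 d)) :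
    Tendsto (fun k => 2 * n k * (X k * Real.log (X k / Y k) - (X k - Y k))) l
      (𝓝 (d ^ 2 / y₀)) := by
  have hη : Tendsto (fun k => (√(n k))⁻¹) l (𝓝 0) :=
    tendsto_inv_atTop_zero.comp (Real.tendsto_sqrt_atTop.comp hn)
  have hv : Tendsto (fun k => (√(n k))⁻¹ * (√(n k) * (X k - Y k)) / Y k) l (𝓝 0) := by
    have := (hη.mul hd).div hY hy₀.ne'
    rwa [zero_mul, zero_div] at this
  have hmain : Tendsto (fun k => (√(n k) * (X k - Y k)) ^ 2 / Y k) l (𝓝 (d ^ 2 / y₀)) :=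
    (hd.pow 2).div hY hy₀.ne'
  have hbound : Tendsto (fun k => 8 * ((√(n k) * (X k - Y k)) ^ 2 / Y k) *
      |(√(n k))⁻¹ * (√(n k) * (X k - Y k)) / Y k|) l (𝓝 0) := by
    simpa using (hmain.const_mul 8).mul hv.abs
  have herr : Tendsto (fun k => 2 * n k * (X k * Real.log (X k / Y k) - (X k - Y k)) -
      (√(n k) * (X k - Y k)) ^ 2 / Y k) l (𝓝 0) := by
    refine squeeze_zero_norm' ?_ hbound
    filter_upwards [hn.eventually_gt_atTop 0, hY.eventually_const_lt hy₀,
      (tendsto_zero_iff_norm_tendsto_zero.1 hv).eventually_le_const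
        (show (0 : ℝ) < 1 / 2 by norm_num)] with k hk hYk hvk
    have hs : √(n k) ^ 2 = n k := Real.sq_sqrt hk.le
    have hs0 : √(n k) ≠ 0 := (Real.sqrt_pos.2 hk).ne'
    have ev : (√(n k))⁻¹ * (√(n k) * (X k - Y k)) / Y k = X k / Y k - 1 := by
      field_simp
    rw [ev] at hvk ⊢
    have h := abs_mul_log_sub_le hvk
    -- Dividing out `Y` reduces the error to the one-variable expansion of `v log v - v + 1` at `v =
    -- X / Y`.
    have e : 2 * n k * (X k * Real.log (X k / Y k) - (X k - Y k)) -
        (√(n k) * (X k - Y k)) ^ 2 / Y k = 2 * n k * Y k *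
        (X k / Y k * Real.log (X k / Y k) - X k / Y k + 1 - (X k / Y k - 1) ^ 2 / 2) := by
      rw [mul_pow, hs]
      field_simp
      ring
    have e2 : 8 * ((√(n k) * (X k - Y k)) ^ 2 / Y k) * |X k / Y k - 1| =
        2 * n k * Y k * (4 * |X k / Y k - 1| ^ 3) := by
      rw [mul_pow, hs, show |X k / Y k - 1| ^ 3 = |X k / Y k - 1| ^ 2 * |X k / Y k - 1| by ring,
        sq_abs]
      field_simp
      ring
    rw [Real.norm_eq_abs, e, e2, abs_mul, abs_of_pos (by positivity)]
    gcongr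
  simpa using herr.add hmain

/-- In each cell `tendsto_lr_term` compares `X = q'` with `Y`, the product of the margins of `q'`
times `depRatio q`. The zeroth order of `X - Y` cancels by definition of `depRatio`. Independence
gives `depRatio q → 1`, so that the first order tends to `indepDeriv` and `Y` to the product of the
margins of `p`. -/
theorem tendsto_lrStat (hp : ∀ a, 0 < p a) (hind : Independence p) (hn : Tendsto n l atTop)
    (hq : Tendsto q l (𝓝 p)) (hu : Tendsto u l (𝓝 u₀)) :
    Tendsto (fun k => lrStat (n k) (q k) (q k + (√(n k))⁻¹ • u k)) l
      (𝓝 (chiForm p u₀)) := by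
  have hη : Tendsto (fun k => (√(n k))⁻¹) l (𝓝 0) :=
    tendsto_inv_atTop_zero.comp (Real.tendsto_sqrt_atTop.comp hn)
  have hrq := fun i => ((continuous_rowMargin i).tendsto p).comp hq
  have hcq := fun i => ((continuous_colMargin i).tendsto p).comp hq
  have hru := fun i => ((continuous_rowMargin i).tendsto u₀).comp hu
  have hcu := fun i => ((continuous_colMargin i).tendsto u₀).comp hu
  simp only [lrStat, Finset.mul_sum, chiForm]
  refine tendsto_finsetSum _ fun a _ => ?_
  have hr0 := rowMargin_pos hp a.1
  have hc0 := colMargin_pos hp a.2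
  have hΔ : Tendsto (fun k => depRatio (q k) a) l (𝓝 1) := by
    have := ((tendsto_pi_nhds.1 hq) a).div ((hrq a.1).mul (hcq a.2)) (mul_pos hr0 hc0).ne'
    rwa [hind a, div_self (mul_pos hr0 hc0).ne'] at this
  refine tendsto_lr_term (mul_pos hr0 hc0) hn ?_ ?_
  · simp only [rowMargin_add_smul, colMargin_add_smul]
    have := (((hrq a.1).add (hη.mul (hru a.1))).mul ((hcq a.2).add (hη.mul (hcu a.2)))).mul hΔ
    simpa using this
  · have hlim : Tendsto (fun k => u k a - depRatio (q k) a *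
        ((rowMargin (u k) a.1 * colMargin (q k) a.2 + rowMargin (q k) a.1 * colMargin (u k) a.2) +
          (√(n k))⁻¹ * (rowMargin (u k) a.1 * colMargin (u k) a.2))) l
        (𝓝 (indepDeriv p u₀ a)) := by
      have := ((tendsto_pi_nhds.1 hu) a).sub (hΔ.mul ((((hru a.1).mul (hcq a.2)).add
        ((hrq a.1).mul (hcu a.2))).add (hη.mul ((hru a.1).mul (hcu a.2)))))
      rwa [zero_mul, add_zero, one_mul] at this
    refine hlim.congr' ?_
    filter_upwards [hn.eventually_gt_atTop 0, (hrq a.1).eventually_const_lt hr0,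
      (hcq a.2).eventually_const_lt hc0] with k hk hrk hck
    simp only [Function.comp_apply] at hrk hck
    have hs0 : √(n k) ≠ 0 := (Real.sqrt_pos.2 hk).ne'
    simp only [rowMargin_add_smul, colMargin_add_smul, Pi.add_apply, Pi.smul_apply, smul_eq_mul]
    have e : q k a = depRatio (q k) a * (rowMargin (q k) a.1 * colMargin (q k) a.2) := by
      rw [depRatio, div_mul_cancel₀ _ (mul_pos hrk hck).ne']
    rw [e]
    generalize depRatio (q k) a = D
    field_simp
    ring

end Statistics

/-! ### Passing from the bootstrap vector to the law of a statistic. -/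

section Transfer

variable {r c : ℕ}

theorem continuous_chiForm_tangent (p : Cell r c → ℝ) :
    Continuous fun s : EuclideanSpace ℝ (FreeCell r c) => chiForm p (tangent s) := by
  have ht : ∀ a, Continuous fun s : EuclideanSpace ℝ (FreeCell r c) => tangent s a := fun a =>
    (continuous_apply a).comp (continuous_tangent.comp (by fun_prop))
  unfold chiForm indepDeriv rowMargin colMargin
  fun_prop

theorem bootLimit_eq_map (Sp : Matrix (FreeCell r c) (FreeCell r c) ℝ) :
    bootLimit Sp = (multivariateGaussian 0 Sp).map fun s => WithLp.toLp 2 ((1 : ℝ), s) := by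
  rw [bootLimit, Measure.dirac_prod, Measure.map_map (by fun_prop) (by fun_prop)]
  rfl

/-- The bootstrap statistic as a function of `bootVec`. -/
noncomputable def statOfVec (T : ℝ → (Cell r c → ℝ) → (Cell r c → ℝ) → ℝ) (n : ℝ)
    (q : Cell r c → ℝ) (x : WithLp 2 (ℝ × EuclideanSpace ℝ (FreeCell r c))) : ℝ :=
  if x.fst = 0 then T n q 0 else T n q (q + (√n)⁻¹ • x.fst⁻¹ • tangent x.snd)

theorem measurable_statOfVec {T : ℝ → (Cell r c → ℝ) → (Cell r c → ℝ) → ℝ} {n : ℝ}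
    {q : Cell r c → ℝ} (hT : Measurable (T n q)) : Measurable (statOfVec T n q) := by
  have h1 : Measurable fun x : WithLp 2 (ℝ × EuclideanSpace ℝ (FreeCell r c)) => x.fst :=
    (by fun_prop : Continuous _).measurable
  have h2 : Measurable fun x : WithLp 2 (ℝ × EuclideanSpace ℝ (FreeCell r c)) =>
      tangent x.snd :=
    (continuous_tangent.comp (by fun_prop)).measurable
  exact Measurable.ite (h1 (measurableSet_singleton 0)) measurable_const
    (hT.comp (((h1.inv.smul h2).const_smul (√n)⁻¹).const_add q))

/-- On the free cells, the bootstrap proportion minus the sample proportion is `n^{-1/2}` times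
score over total, exactly; zero total sum fixes the last cell. -/
theorem statOfVec_bootVec {ι : Type*} (T : ℝ → (Cell r c → ℝ) → (Cell r c → ℝ) → ℝ) {N : ℕ}
    {A : Finset ι} {incl : ι → ℝ} (y : ι → Cell r c) (m : ι → ℕ) (hN : (N : ℝ) ≠ 0)
    (hA : A.Nonempty) (hW : ∑ i ∈ A, (incl i)⁻¹ ≠ 0) :
    statOfVec T A.card (sampleProp A incl y) (bootVec N A incl y m) =
      T A.card (sampleProp A incl y) (bootProp A incl y m) := by
  have hc : (0 : ℝ) < A.card := by exact_mod_cast hA.card_pos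
  have hs : √(A.card : ℝ) ≠ 0 := (Real.sqrt_pos.2 hc).ne'
  have hfst : (bootVec N A incl y m).fst = (∑ i ∈ A, (incl i)⁻¹ * m i) / N := rfl
  unfold statOfVec
  split_ifs with h
  -- A vanishing bootstrap total makes `cellProp` a division by zero, hence the zero vector, which
  -- is the value `statOfVec` uses there.
  · rw [hfst, div_eq_zero_iff, or_iff_left hN] at h
    congr 1
    funext a
    simp [bootProp, cellProp, h]
  · have hV : ∑ i ∈ A, (incl i)⁻¹ * m i ≠ 0 := fun h0 => h (by rw [hfst, h0, zero_div])
    congr 1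
    have hsum : ∑ a, (bootProp A incl y m - sampleProp A incl y) a = 0 := by
      simp only [Pi.sub_apply, Finset.sum_sub_distrib]
      rw [bootProp, sum_cellProp y hV, sampleProp, sum_cellProp y hW, sub_self]
    symm
    rw [← sub_eq_iff_eq_add', eq_tangent hsum]
    symm
    have hsm : ∀ (k : ℝ) (s : FreeCell r c → ℝ), k • tangent s = tangent (k • s) := fun k s => by
      funext a
      simp only [tangent, Pi.smul_apply, smul_eq_mul]
      split_ifs
      · rfl
      · rw [mul_neg, Finset.mul_sum]
    rw [hsm, hsm]
    congr 1
    funext a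
    have hsnd : (bootVec N A incl y m).snd a = √A.card / N * ∑ i ∈ A, (incl i)⁻¹ * m i *
      ((if y i = a.1 then 1 else 0) - sampleProp A incl y a.1) := rfl
    simp only [Pi.smul_apply, smul_eq_mul, hsnd, hfst, Pi.sub_apply, bootProp]
    rw [cellProp]
    simp only [mul_sub, Finset.sum_sub_distrib, ← Finset.sum_mul, mul_ite, mul_one, mul_zero]
    generalize ∑ i ∈ A, (incl i)⁻¹ * (m i : ℝ) = V at hV ⊢
    generalize (∑ i ∈ A, if y i = a.1 then (incl i)⁻¹ * (m i : ℝ) else 0) = V'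
    field_simp

/-- The limit law lives on `fst = 1`. Near such points the total is nonzero and the direction `fst⁻¹
• tangent snd` is continuous, so `hT` along `atTop ×ˢ 𝓝 x` is the continuous convergence required by
the mapping theorem. -/
theorem RegularSamples.tendsto_integral_bootStatLaw {p : Cell r c → ℝ}
    {Sp : Matrix (FreeCell r c) (FreeCell r c) ℝ} {C₁ C₂ : ℝ}
    {N : ℕ → ℕ} {n₀ : ℕ → ℝ} {A : ∀ j, Finset (Fin (N j))} {incl : ∀ j, Fin (N j) → ℝ}
    {y : ∀ j, Fin (N j) → Cell r c} (h : RegularSamples p Sp C₁ C₂ N n₀ A incl y) (hC₁ : 0 < C₁)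
    (hp : ∑ a, p a = 1) (hSp : Sp.PosSemidef)
    {T : ℝ → (Cell r c → ℝ) → (Cell r c → ℝ) → ℝ} (hTm : ∀ n q, Measurable (T n q))
    (hT : ∀ {l : Filter (ℕ × WithLp 2 (ℝ × EuclideanSpace ℝ (FreeCell r c)))}
      {n : ℕ × WithLp 2 (ℝ × EuclideanSpace ℝ (FreeCell r c)) → ℝ}
      {q u : ℕ × WithLp 2 (ℝ × EuclideanSpace ℝ (FreeCell r c)) → Cell r c → ℝ}
      {u₀ : Cell r c → ℝ}, Tendsto n l atTop → Tendsto q l (𝓝 p) → Tendsto u l (𝓝 u₀) →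
      Tendsto (fun k => T (n k) (q k) (q k + (√(n k))⁻¹ • u k)) l (𝓝 (chiForm p u₀)))
    (f : BoundedContinuousFunction ℝ ℝ) :
    Tendsto (fun j => ∫ x, f x ∂(bootStatLaw T (A j) (incl j) (y j))) atTop
      (𝓝 (∫ s : EuclideanSpace ℝ (FreeCell r c), f (chiForm p (tangent s))
        ∂(multivariateGaussian 0 Sp))) := by
  obtain ⟨μ, hμ, hlim⟩ := h.exists_tendsto_bootVec hC₁ hp hSp
  have hmk : Measurable fun s : EuclideanSpace ℝ (FreeCell r c) =>
      (WithLp.toLp 2 ((1 : ℝ), s) : WithLp 2 (ℝ × EuclideanSpace ℝ (FreeCell r c))) := by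
    fun_prop
  have hchi' : Continuous fun x : WithLp 2 (ℝ × EuclideanSpace ℝ (FreeCell r c)) =>
      chiForm p (tangent x.snd) := (continuous_chiForm_tangent p).comp (by fun_prop)
  have key := tendsto_integral_comp_of_continuous_convergence hlim
    (G := fun j => statOfVec T (A j).card (sampleProp (A j) (incl j) (y j)))
    (G₀ := fun x => chiForm p (tangent x.snd))
    (fun j => measurable_statOfVec (hTm _ _)) hchi'.measurable ?_ f
  · change Tendsto _ _ (𝓝 (∫ x, f (chiForm p (tangent x.snd)) ∂(bootLimit Sp))) at key
    have hmap := integral_map hmk.aemeasurable (μ := multivariateGaussian 0 Sp)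
      (f.continuous.comp hchi').aestronglyMeasurable
    simp only [Function.comp_apply] at hmap
    rw [bootLimit_eq_map, hmap] at key
    refine key.congr' ?_
    filter_upwards [hμ, h.eventually_pos hC₁] with j hj ⟨_, hN, hA, hi⟩
    have hG : Measurable fun x =>
        f (statOfVec T (A j).card (sampleProp (A j) (incl j) (y j)) x) :=
      f.continuous.measurable.comp (measurable_statOfVec (hTm _ _))
    rw [hj, integral_map Measurable.of_discrete.aemeasurable hG.aestronglyMeasurable, bootStatLaw, integral_map Measurable.of_discrete.aemeasurable
        f.continuous.aestronglyMeasurable]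
    refine integral_congr_ae (Eventually.of_forall fun m => ?_)
    simp only
    rw [statOfVec_bootVec T (y j) m (by exact_mod_cast hN.ne') hA
      (Finset.sum_pos (fun i _ => inv_pos.2 (hi i).1) hA).ne']
  · change ∀ᵐ x ∂(bootLimit Sp), _
    have hfst1 : ∀ᵐ x ∂(bootLimit Sp), x.fst = 1 := by
      rw [bootLimit_eq_map]
      exact (ae_map_iff hmk.aemeasurable
        ((by fun_prop : Continuous fun x : WithLp 2 (ℝ × EuclideanSpace ℝ (FreeCell r c)) =>
          x.fst).measurable (measurableSet_singleton 1))).2 (Eventually.of_forall fun s => rfl)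
    filter_upwards [hfst1] with x hx
    have hs2 : Tendsto (fun k : ℕ × WithLp 2 (ℝ × EuclideanSpace ℝ (FreeCell r c)) => k.2)
        (atTop ×ˢ 𝓝 x) (𝓝 x) := tendsto_snd
    have hfst : Tendsto (fun k : ℕ × WithLp 2 (ℝ × EuclideanSpace ℝ (FreeCell r c)) => k.2.fst)
        (atTop ×ˢ 𝓝 x) (𝓝 1) := by
      rw [← hx]
      exact ((by fun_prop : Continuous fun x : WithLp 2 (ℝ × EuclideanSpace ℝ (FreeCell r c)) =>
          x.fst).tendsto x).comp hs2
    have hsnd : Tendsto (fun k : ℕ × WithLp 2 (ℝ × EuclideanSpace ℝ (FreeCell r c)) =>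
        tangent k.2.snd) (atTop ×ˢ 𝓝 x) (𝓝 (tangent x.snd)) :=
      ((continuous_tangent.comp (by fun_prop : Continuous
        fun x : WithLp 2 (ℝ × EuclideanSpace ℝ (FreeCell r c)) =>
          (x.snd : FreeCell r c → ℝ))).tendsto x).comp hs2
    have hu := (hfst.inv₀ one_ne_zero).smul hsnd
    rw [inv_one, one_smul] at hu
    have hq : Tendsto (fun k : ℕ × WithLp 2 (ℝ × EuclideanSpace ℝ (FreeCell r c)) =>
        sampleProp (A k.1) (incl k.1) (y k.1)) (atTop ×ˢ 𝓝 x) (𝓝 p) :=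
      (tendsto_pi_nhds.2 fun a => h.tendsto_sampleProp hC₁ hp a).comp tendsto_fst
    have hn := h.tendsto_card.comp (tendsto_fst (f := atTop) (g := 𝓝 x))
    refine (hT hn hq hu).congr' ?_
    filter_upwards [hfst.eventually_ne one_ne_zero] with k hk
    exact (if_neg hk).symm

end Transfer

/-! ### The limiting quadratic form and the spectrum of the design effect matrix. -/

section LimitLaw

open Matrix

/-- The inverse of a multinomial covariance matrix. -/
theorem inv_diagonal_sub_vecMulVec {ι : Type*} [Fintype ι] [DecidableEq ι] {π : ι → ℝ} {s : ℝ}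
    (hπ : ∀ i, π i ≠ 0) (hs : s ≠ 0) (hsum : ∑ i, π i = 1 - s) :
    (diagonal π - vecMulVec π π)⁻¹ =
      diagonal (fun i => (π i)⁻¹) + s⁻¹ • vecMulVec (fun _ => 1) (fun _ => 1) := by
  refine inv_eq_right_inv ?_
  have h1 : vecMulVec π π * diagonal (fun i => (π i)⁻¹) = vecMulVec π (fun _ => (1 : ℝ)) := by
    ext i j
    simp [mul_diagonal, vecMulVec_apply, hπ j]
  have h2 : diagonal π * vecMulVec (fun _ => (1 : ℝ)) (fun _ => 1) = vecMulVec π (fun _ => 1) := by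
    ext i j
    simp [diagonal_mul, vecMulVec_apply]
  have h3 : vecMulVec π π * vecMulVec (fun _ => (1 : ℝ)) (fun _ => 1) =
      (1 - s) • vecMulVec π (fun _ => 1) := by
    ext i j
    simp [mul_apply, vecMulVec_apply, ← Finset.mul_sum, hsum]
    ring
  have h4 : diagonal π * diagonal (fun i => (π i)⁻¹) = 1 := by
    rw [diagonal_mul_diagonal, ← diagonal_one]
    congr 1
    funext i
    exact mul_inv_cancel₀ (hπ i)
  rw [sub_mul, mul_add, mul_add, mul_smul_comm, mul_smul_comm, h1, h2, h3, h4]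
  have : s⁻¹ • vecMulVec π (fun _ : ι => (1 : ℝ)) - (vecMulVec π (fun _ => 1) +
      s⁻¹ • (1 - s) • vecMulVec π (fun _ => 1)) = 0 := by
    rw [smul_smul, mul_sub, inv_mul_cancel₀ hs, sub_smul, mul_one, one_smul]
    abel
  rw [add_sub_assoc, this, add_zero]

theorem posSemidef_inv_diagonal_sub_vecMulVec {ι : Type*} [Fintype ι] [DecidableEq ι]
    {π : ι → ℝ} {s : ℝ} (hπ : ∀ i, 0 < π i) (hs : 0 < s) (hsum : ∑ i, π i = 1 - s) :
    (diagonal π - vecMulVec π π)⁻¹.PosSemidef := by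
  rw [inv_diagonal_sub_vecMulVec (fun i => (hπ i).ne') hs.ne' hsum]
  refine PosSemidef.add (PosSemidef.diagonal fun i => (inv_pos.2 (hπ i)).le) ?_
  refine PosSemidef.smul ?_ (inv_pos.2 hs).le
  simpa using posSemidef_vecMulVec_self_star (fun _ : ι => (1 : ℝ))

/-- The chi-square form of two vectors with zero sum, through the inverse multinomial covariance
matrix of the first coordinates. -/
theorem sum_div_eq_sum_inv {n : ℕ} {ρ v w : Fin (n + 1) → ℝ} (hρ : ∀ i, 0 < ρ i)
    (hsum : ∑ i, ρ i = 1) (hv : ∑ i, v i = 0) (hw : ∑ i, w i = 0)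
    {M : Matrix (Fin n) (Fin n) ℝ} (hM : M = diagonal (fun i => ρ i.castSucc) -
      vecMulVec (fun i => ρ i.castSucc) (fun i => ρ i.castSucc)) :
    ∑ i, v i * w i / ρ i =
      ∑ i : Fin n, ∑ k : Fin n, v i.castSucc * w k.castSucc * M⁻¹ i k := by
  rw [Fin.sum_univ_castSucc] at hsum hv hw ⊢
  rw [hM, inv_diagonal_sub_vecMulVec (π := fun i : Fin n => ρ i.castSucc) (fun i => (hρ i.castSucc).ne') (hρ (Fin.last n)).ne'
    (by linarith)]
  simp only [Matrix.add_apply, Matrix.smul_apply, vecMulVec_apply, mul_one, smul_eq_mul,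
    diagonal_apply, mul_add, Finset.sum_add_distrib, mul_ite, mul_zero, Finset.sum_ite_eq,
    Finset.mem_univ, if_true]
  simp only [← Finset.sum_mul, ← Finset.mul_sum]
  -- Because the vectors sum to zero, the rank-one part of the inverse is exactly the term of the
  -- last index.
  rw [show ∑ i : Fin n, v i.castSucc = -v (Fin.last n) by linarith,
    show ∑ i : Fin n, w i.castSucc = -w (Fin.last n) by linarith]
  simp only [div_eq_mul_inv, neg_mul_neg]

variable {r c : ℕ} {p : Cell r c → ℝ}

theorem sum_rowMargin (q : Cell r c → ℝ) : ∑ i, rowMargin q i = ∑ a, q a :=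
  (Fintype.sum_prod_type q).symm

theorem sum_colMargin (q : Cell r c → ℝ) : ∑ j, colMargin q j = ∑ a, q a :=
  (Fintype.sum_prod_type_right q).symm

theorem sum_indepDeriv_row {u : Cell r c → ℝ} (hsum : ∑ a, p a = 1) (hu : ∑ a, u a = 0)
    (i : Fin (r + 1)) : ∑ j, indepDeriv p u (i, j) = 0 := by
  simp only [indepDeriv, Finset.sum_sub_distrib, Finset.sum_add_distrib, ← Finset.mul_sum,
    sum_colMargin, hsum, hu]
  simp [rowMargin]

theorem sum_indepDeriv_col {u : Cell r c → ℝ} (hsum : ∑ a, p a = 1) (hu : ∑ a, u a = 0)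
    (j : Fin (c + 1)) : ∑ i, indepDeriv p u (i, j) = 0 := by
  simp only [indepDeriv, Finset.sum_sub_distrib, Finset.sum_add_distrib, ← Finset.sum_mul,
    sum_rowMargin, hsum, hu]
  simp [colMargin]

/-- `indepDeriv p u` has zero row and column sums, so `sum_div_eq_sum_inv` applies in each direction
and eliminates the last column and the last row; the two inverses combine to the Kronecker product.
-/
theorem chiForm_eq_dotProduct {u : Cell r c → ℝ} (hp : ∀ a, 0 < p a) (hsum : ∑ a, p a = 1)
    (hu : ∑ a, u a = 0) {g : Fin r × Fin c → ℝ}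
    (hg : ∀ a, g a = indepDeriv p u (a.1.castSucc, a.2.castSucc)) :
    chiForm p u = g ⬝ᵥ (kronecker (rowCov p)⁻¹ (colCov p)⁻¹) *ᵥ g := by
  have hR := fun j k => sum_div_eq_sum_inv (rowMargin_pos hp)
    (by rw [sum_rowMargin, hsum]) (sum_indepDeriv_col hsum hu j) (sum_indepDeriv_col hsum hu k)
    (M := rowCov p) rfl
  have hC := fun i => sum_div_eq_sum_inv (colMargin_pos hp)
    (by rw [sum_colMargin, hsum]) (sum_indepDeriv_row hsum hu i) (sum_indepDeriv_row hsum hu i)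
    (M := colCov p) rfl
  calc chiForm p u = ∑ i, (∑ j, indepDeriv p u (i, j) * indepDeriv p u (i, j) / colMargin p j) /
        rowMargin p i := by
        rw [chiForm, Fintype.sum_prod_type]
        refine Finset.sum_congr rfl fun i _ => ?_
        rw [Finset.sum_div]
        refine Finset.sum_congr rfl fun j _ => ?_
        rw [sq, div_div, mul_comm (colMargin p j)]
    _ = ∑ j : Fin c, ∑ l : Fin c, (colCov p)⁻¹ j l *
        ∑ i, indepDeriv p u (i, j.castSucc) * indepDeriv p u (i, l.castSucc) / rowMargin p i := by
        simp only [hC, Finset.sum_div, Finset.mul_sum]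
        rw [Finset.sum_comm]
        refine Finset.sum_congr rfl fun j _ => ?_
        rw [Finset.sum_comm]
        exact Finset.sum_congr rfl fun l _ => Finset.sum_congr rfl fun i _ => by ring
    _ = g ⬝ᵥ (kronecker (rowCov p)⁻¹ (colCov p)⁻¹) *ᵥ g := by
        simp only [hR, dotProduct, mulVec, Fintype.sum_prod_type, Finset.mul_sum,
          kronecker, kroneckerMap_apply, hg]
        refine (Finset.sum_congr rfl fun j _ => Finset.sum_comm).trans (Finset.sum_comm.trans ?_)
        refine Finset.sum_congr rfl fun i _ => Finset.sum_congr rfl fun j _ => ?_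
        refine Finset.sum_comm.trans ?_
        exact Finset.sum_congr rfl fun k _ => Finset.sum_congr rfl fun l _ => by ring

/-- The formula for the Jacobian entries vanishes at the last cell, so the sum over free cells
extends to the whole table. -/
theorem indepDeriv_tangent_eq_jacobian (p : Cell r c → ℝ) (s : FreeCell r c → ℝ)
    (a : Fin r × Fin c) :
    (jacobian p *ᵥ s) a = indepDeriv p (tangent s) (a.1.castSucc, a.2.castSucc) := by
  obtain ⟨i, j⟩ := a
  set f : Cell r c → ℝ := fun b => ((if b = (i.castSucc, j.castSucc) then 1 else 0) -
    ((if b.1 = i.castSucc then colMargin p j.castSucc else 0) +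
      (if b.2 = j.castSucc then rowMargin p i.castSucc else 0))) * tangent s b with hf
  have hlast : f (Fin.last r, Fin.last c) = 0 := by
    have h1 : Fin.last r ≠ i.castSucc := (Fin.castSucc_lt_last i).ne'
    have h2 : Fin.last c ≠ j.castSucc := (Fin.castSucc_lt_last j).ne'
    simp [hf, h1, h2]
  have h1 : (jacobian p *ᵥ s) (i, j) = ∑ b, f b := by
    rw [sum_eq_last_add_sum_free, hlast, zero_add]
    simp only [mulVec, dotProduct, jacobian_apply, hf, tangent_free]
  rw [h1]
  simp only [hf, sub_mul, add_mul, Finset.sum_sub_distrib, Finset.sum_add_distrib, ite_mul,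
    one_mul, zero_mul, Finset.sum_ite_eq', Finset.mem_univ, if_true, indepDeriv]
  congr 2
  · rw [Fintype.sum_prod_type_right]
    simp [rowMargin, Finset.mul_sum, mul_comm]
  · rw [Fintype.sum_prod_type]
    simp [colMargin, Finset.mul_sum]

theorem posSemidef_kronecker_inv (hp : ∀ a, 0 < p a) (hsum : ∑ a, p a = 1) :
    (kronecker (rowCov p)⁻¹ (colCov p)⁻¹).PosSemidef := by
  have hr := sum_rowMargin p
  have hc := sum_colMargin p
  rw [Fin.sum_univ_castSucc, hsum] at hr hc
  exact (posSemidef_inv_diagonal_sub_vecMulVec (fun i => rowMargin_pos hp _)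
    (rowMargin_pos hp (Fin.last r)) (by linarith)).kronecker
    (posSemidef_inv_diagonal_sub_vecMulVec (fun i => colMargin_pos hp _)
    (colMargin_pos hp (Fin.last c)) (by linarith))

open scoped MatrixOrder in
theorem exists_eq_transpose_mul_self {ι : Type*} [Fintype ι] {M : Matrix ι ι ℝ}
    (hM : M.PosSemidef) : ∃ C : Matrix ι ι ℝ, M = Cᵀ * C := by
  classical
  obtain ⟨C, hC⟩ := CStarAlgebra.nonneg_iff_eq_star_mul_self.1 hM.nonneg
  rw [star_eq_conjTranspose, conjTranspose_eq_transpose_of_trivial] at hC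
  exact ⟨C, hC⟩

/-- The law of the squared norm of a Gaussian vector with independent coordinates. -/
theorem map_sum_sq_eq_weightedChiSq {ι : Type*} [Fintype ι] [DecidableEq ι] {S : Matrix ι ι ℝ}
    (hS : S.PosSemidef) {d : ℕ} {δ : Fin d → ℝ} (hδ : ∀ l, 0 ≤ δ l) {B : Matrix (Fin d) ι ℝ}
    (hB : B * S * Bᵀ = diagonal δ) :
    (multivariateGaussian 0 S).map (fun s => ∑ l, (B *ᵥ s.ofLp) l ^ 2) = weightedChiSq δ := by
  have hlin : Continuous fun s : EuclideanSpace ℝ ι => WithLp.toLp 2 (B *ᵥ s.ofLp) := by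
    have : Continuous fun v : ι → ℝ => B *ᵥ v :=
      continuous_pi fun l => by simp only [mulVec, dotProduct]; fun_prop
    exact (PiLp.continuous_toLp 2 _).comp (this.comp (PiLp.continuous_ofLp 2 _))
  have hscale : Measurable fun z : Fin d → ℝ => WithLp.toLp 2 fun l => √(δ l) * z l := by
    fun_prop
  -- Both sides are centred Gaussian with covariance `diagonal δ`. Comparing characteristic
  -- functions also covers vanishing `δ l`.
  have hlaw : (multivariateGaussian 0 S).map (fun s => WithLp.toLp 2 (B *ᵥ s.ofLp)) =
      (Measure.pi fun _ : Fin d => gaussianReal 0 1).map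
        fun z => WithLp.toLp 2 fun l => √(δ l) * z l := by
    have : IsProbabilityMeasure ((multivariateGaussian 0 S).map
        fun s => WithLp.toLp 2 (B *ᵥ s.ofLp)) :=
      Measure.isProbabilityMeasure_map hlin.measurable.aemeasurable
    have : IsProbabilityMeasure ((Measure.pi fun _ : Fin d => gaussianReal 0 1).map
        fun z => WithLp.toLp 2 fun l => √(δ l) * z l) :=
      Measure.isProbabilityMeasure_map hscale.aemeasurable
    refine Measure.ext_of_charFun ?_
    funext t
    have h1 : charFun ((multivariateGaussian 0 S).map fun s => WithLp.toLp 2 (B *ᵥ s.ofLp)) t =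
        charFun (multivariateGaussian 0 S) (WithLp.toLp 2 (Bᵀ *ᵥ t.ofLp)) := by
      rw [charFun_apply, charFun_apply, integral_map hlin.measurable.aemeasurable
        (Continuous.aestronglyMeasurable (by fun_prop))]
      refine integral_congr_ae (Eventually.of_forall fun s => ?_)
      have : inner ℝ (WithLp.toLp 2 (B *ᵥ s.ofLp)) t =
          inner ℝ s (WithLp.toLp 2 (Bᵀ *ᵥ t.ofLp)) := by
        simp only [EuclideanSpace.inner_eq_star_dotProduct, star_trivial]
        rw [dotProduct_mulVec, mulVec_transpose]
      simp only [this]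
    have h2 : (Measure.pi fun _ : Fin d => gaussianReal 0 1).map
        (fun z => WithLp.toLp 2 fun l => √(δ l) * z l) =
        (Measure.pi fun l => gaussianReal 0 (δ l).toNNReal).map (WithLp.toLp 2) := by
      have h3 := Measure.pi_map_pi (μ := fun _ : Fin d => gaussianReal 0 1)
        (f := fun l x => √(δ l) * x) (fun l => by fun_prop)
      have h4 : (fun l => (gaussianReal 0 1).map fun x => √(δ l) * x) =
          fun l => gaussianReal 0 (δ l).toNNReal := by
        funext l
        rw [gaussianReal_map_const_mul, mul_zero, mul_one]
        congr 1
        ext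
        simp [Real.sq_sqrt (hδ l), hδ l]
      rw [h4] at h3
      rw [← h3, Measure.map_map (by fun_prop) (by fun_prop)]
      rfl
    rw [h1, h2, charFun_pi, charFun_multivariateGaussian hS]
    simp only [charFun_gaussianReal, inner_zero_right, Complex.ofReal_zero, zero_mul, zero_sub,
      mul_zero, ← Complex.exp_sum]
    congr 1
    have h5 : (Bᵀ *ᵥ t.ofLp) ⬝ᵥ S *ᵥ (Bᵀ *ᵥ t.ofLp) = ∑ l, δ l * t.ofLp l ^ 2 := by
      have h6 : (Bᵀ *ᵥ t.ofLp) ⬝ᵥ S *ᵥ (Bᵀ *ᵥ t.ofLp) = t.ofLp ⬝ᵥ (B * S * Bᵀ) *ᵥ t.ofLp := by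
        rw [← mulVec_mulVec, ← mulVec_mulVec, dotProduct_mulVec t.ofLp B, mulVec_transpose]
      rw [h6, hB]
      simp only [dotProduct, mulVec_diagonal]
      exact Finset.sum_congr rfl fun l _ => by ring
    rw [h5]
    push_cast
    rw [Finset.sum_neg_distrib, Finset.sum_div]
    congr 1
    refine Finset.sum_congr rfl fun l _ => ?_
    rw [← Real.coe_toNNReal _ (hδ l)]
    simp
  have hsq : Measurable fun v : EuclideanSpace ℝ (Fin d) => ∑ l, v l ^ 2 := by fun_prop
  have := congrArg (Measure.map fun v : EuclideanSpace ℝ (Fin d) => ∑ l, v l ^ 2) hlaw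
  rw [Measure.map_map hsq hlin.measurable, Measure.map_map hsq hscale] at this
  rw [weightedChiSq]
  convert! this using 2
  funext z
  simp [mul_pow, Real.sq_sqrt (hδ _)]

/-- `D_h` is not symmetric, but with kernel `CᵀC` it is `Cᵀ (C J Sp Jᵀ)`, which has the
characteristic polynomial of the positive semidefinite `Γ = C J Sp Jᵀ Cᵀ`. The eigenvectors `U` of
`Γ` give independent coordinates `Uᵀ C J s`, whose squared norm is the quadratic form. -/
theorem exists_spectrum_designEffect {Sp : Matrix (FreeCell r c) (FreeCell r c) ℝ}
    (hp : ∀ a, 0 < p a) (hsum : ∑ a, p a = 1) (hSp : Sp.PosSemidef) :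
    ∃ δ : Fin (r * c) → ℝ, Monotone δ ∧
      (designEffect p Sp).charpoly = ∏ l, (Polynomial.X - Polynomial.C (δ l)) ∧
      (multivariateGaussian 0 Sp).map (fun s => chiForm p (tangent s.ofLp)) =
        weightedChiSq δ := by
  obtain ⟨C, hC⟩ := exists_eq_transpose_mul_self (posSemidef_kronecker_inv hp hsum)
  set J := jacobian p with hJ
  set Γ := C * (J * Sp * Jᵀ) * Cᵀ with hΓ
  have hΓpsd : Γ.PosSemidef := by
    have := hSp.mul_mul_conjTranspose_same (C * J)
    rw [conjTranspose_eq_transpose_of_trivial, transpose_mul] at this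
    simpa only [hΓ, Matrix.mul_assoc] using this
  have hherm := hΓpsd.isHermitian
  set e₀ : Fin (r * c) ≃ Fin r × Fin c := finProdFinEquiv.symm
  set e : Fin (r * c) ≃ Fin r × Fin c := (Tuple.sort (hherm.eigenvalues ∘ e₀)).trans e₀ with he
  set U : Matrix (Fin r × Fin c) (Fin r × Fin c) ℝ := hherm.eigenvectorUnitary.1
  have hUU : U * Uᵀ = 1 := by
    have := Unitary.coe_mul_star_self hherm.eigenvectorUnitary
    rw [Unitary.coe_star] at this
    rwa [star_eq_conjTranspose, conjTranspose_eq_transpose_of_trivial] at this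
  have hUU' : Uᵀ * U = 1 := by
    have := Unitary.coe_star_mul_self hherm.eigenvectorUnitary
    rwa [star_eq_conjTranspose, conjTranspose_eq_transpose_of_trivial] at this
  have hspec : Uᵀ * Γ * U = diagonal hherm.eigenvalues := by
    have h1 : Γ = U * diagonal hherm.eigenvalues * Uᵀ := by
      have := hherm.spectral_theorem
      rw [Unitary.conjStarAlgAut_apply, star_eq_conjTranspose,
        conjTranspose_eq_transpose_of_trivial] at this
      exact this
    calc Uᵀ * Γ * U = Uᵀ * (U * diagonal hherm.eigenvalues * Uᵀ) * U := by rw [← h1]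
      _ = (Uᵀ * U) * diagonal hherm.eigenvalues * (Uᵀ * U) := by simp only [Matrix.mul_assoc]
      _ = diagonal hherm.eigenvalues := by rw [hUU', Matrix.one_mul, Matrix.mul_one]
  refine ⟨hherm.eigenvalues ∘ e, ?_, ?_, ?_⟩
  · exact Tuple.monotone_sort (hherm.eigenvalues ∘ e₀)
  · have h1 : (designEffect p Sp).charpoly = Γ.charpoly := by
      rw [designEffect, hC, Matrix.mul_assoc, charpoly_mul_comm]
    rw [h1, hherm.charpoly_eq]
    exact (Equiv.prod_comp e fun i => Polynomial.X - Polynomial.C (hherm.eigenvalues i)).symm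
  · set B : Matrix (Fin (r * c)) (FreeCell r c) ℝ := (Uᵀ * C * J).submatrix e id with hB
    have hBS : B * Sp * Bᵀ = diagonal (hherm.eigenvalues ∘ e) := by
      have h1 : B * Sp * Bᵀ = (Uᵀ * Γ * U).submatrix e e := by
        rw [hB, transpose_submatrix, hΓ]
        conv_lhs => rw [← submatrix_id_id Sp]
        rw [← submatrix_mul _ _ _ _ _ Function.bijective_id,
          ← submatrix_mul _ _ _ _ _ Function.bijective_id]
        simp only [transpose_mul, transpose_transpose, Matrix.mul_assoc]
      rw [h1, hspec, submatrix_diagonal_equiv]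
    rw [← map_sum_sq_eq_weightedChiSq (δ := hherm.eigenvalues ∘ e) hSp
      (fun l => hΓpsd.eigenvalues_nonneg _) hBS]
    congr 1
    funext s
    rw [chiForm_eq_dotProduct hp hsum (sum_tangent _)
      (fun a => indepDeriv_tangent_eq_jacobian p s.ofLp a), hC]
    have h1 : ∀ l, (B *ᵥ s.ofLp) l = ((Uᵀ * C * J) *ᵥ s.ofLp) (e l) := fun l => rfl
    simp only [h1]
    rw [Equiv.sum_comp e fun k => ((Uᵀ * C * J) *ᵥ s.ofLp) k ^ 2]
    have h2 : ∑ k, ((Uᵀ * C * J) *ᵥ s.ofLp) k ^ 2 =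
        ((Uᵀ * C * J) *ᵥ s.ofLp) ⬝ᵥ ((Uᵀ * C * J) *ᵥ s.ofLp) := by
      simp only [dotProduct, sq]
    have h3 : (Uᵀ * C * J) *ᵥ s.ofLp = Uᵀ *ᵥ (C *ᵥ (J *ᵥ s.ofLp)) := by
      rw [mulVec_mulVec, mulVec_mulVec, Matrix.mul_assoc]
    have h4 : ∀ x : Fin r × Fin c → ℝ, (Uᵀ *ᵥ x) ⬝ᵥ (Uᵀ *ᵥ x) = x ⬝ᵥ x := fun x => by
      rw [dotProduct_mulVec, vecMul_transpose, mulVec_mulVec, hUU, one_mulVec]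
    rw [h2, h3, h4, ← mulVec_mulVec, dotProduct_mulVec, vecMul_transpose]

end LimitLaw

/-! ### Moments of sums over one Poisson sample. -/

section PoissonSampling

variable {K Ω : Type*} {N : ℕ} {y : Fin N → Ω → K} {incl : Fin N → Ω → ℝ}
  {A : Ω → Finset (Fin N)}

theorem inclusion_mem (A : Ω → Finset (Fin N)) (i : Fin N) (ω : Ω) :
    inclusion A i ω = 0 ∨ inclusion A i ω = 1 := by
  unfold inclusion
  split_ifs
  exacts [Or.inr rfl, Or.inl rfl]

theorem abs_inclusion_le (A : Ω → Finset (Fin N)) (i : Fin N) (ω : Ω) :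
    |inclusion A i ω| ≤ 1 := by
  rcases inclusion_mem A i ω with h | h <;> simp [h]

theorem sum_sample_eq (A : Ω → Finset (Fin N)) (f : Fin N → ℝ) (ω : Ω) :
    ∑ i ∈ A ω, f i = ∑ i, f i * inclusion A i ω := by
  simp [inclusion, Finset.sum_ite_mem]

variable [MeasurableSpace Ω] {P : Measure Ω}

theorem ae_norm_term_le {g : K × ℝ → ℝ} {M : ℝ}
    (hb : ∀ i, ∀ᵐ ω ∂P, |g (y i ω, incl i ω)| ≤ M) (i : Fin N) :
    ∀ᵐ ω ∂P, ‖g (y i ω, incl i ω) * inclusion A i ω‖ ≤ M := by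
  filter_upwards [hb i] with ω hω
  rw [Real.norm_eq_abs, abs_mul]
  exact (mul_le_of_le_one_right (abs_nonneg _) (abs_inclusion_le A i ω)).trans hω

namespace IsPoissonSample

variable [MeasurableSpace K] {g g' : K × ℝ → ℝ} {M M' : ℝ}

theorem measurable_term (h : IsPoissonSample P y incl A) (hg : Measurable g) (i : Fin N) :
    Measurable fun ω => g (y i ω, incl i ω) * inclusion A i ω :=
  (hg.comp ((h.measurable_cat i).prodMk (h.measurable_incl i))).mul (h.measurable_sample i)

theorem iIndepFun_term (h : IsPoissonSample P y incl A) (hg : Measurable g) :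
    iIndepFun (fun i ω => g (y i ω, incl i ω) * inclusion A i ω) P :=
  h.indep.comp (fun _ x => g (x.1, x.2.1) * x.2.2) fun _ => by fun_prop

variable [IsProbabilityMeasure P]

theorem memLp_term (h : IsPoissonSample P y incl A) (hg : Measurable g)
    (hb : ∀ i, ∀ᵐ ω ∂P, |g (y i ω, incl i ω)| ≤ M) (i : Fin N) :
    MemLp (fun ω => g (y i ω, incl i ω) * inclusion A i ω) 2 P :=
  MemLp.of_bound (h.measurable_term hg i).aestronglyMeasurable M (ae_norm_term_le hb i)

/-- The factor `g` is measurable for the conditioning σ-algebra and can be pulled out; the indicator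
is then replaced by its conditional mean `incl`. -/
theorem integral_term (h : IsPoissonSample P y incl A) (hg : Measurable g)
    (hb : ∀ i, ∀ᵐ ω ∂P, |g (y i ω, incl i ω)| ≤ M) (i : Fin N) :
    ∫ ω, g (y i ω, incl i ω) * inclusion A i ω ∂P =
      ∫ ω, g (y i ω, incl i ω) * incl i ω ∂P := by
  have hle := ((h.measurable_cat i).prodMk (h.measurable_incl i)).comap_le
  have hsm : StronglyMeasurable[MeasurableSpace.comap (fun ω => (y i ω, incl i ω)) inferInstance]
      fun ω => g (y i ω, incl i ω) :=
    (hg.comp (comap_measurable _)).stronglyMeasurable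
  have hI : Integrable (inclusion A i) P :=
    Integrable.of_bound (h.measurable_sample i).aestronglyMeasurable 1
      (Eventually.of_forall fun ω => abs_inclusion_le A i ω)
  have hfI : Integrable ((fun ω => g (y i ω, incl i ω)) * inclusion A i) P :=
    (h.memLp_term hg hb i).integrable one_le_two
  have h1 := condExp_mul_of_stronglyMeasurable_left hsm hfI hI
  have h2 := integral_condExp (f := (fun ω => g (y i ω, incl i ω)) * inclusion A i) (μ := P) hle
  change _ = ∫ ω, g (y i ω, incl i ω) * inclusion A i ω ∂P at h2
  rw [← h2]
  refine integral_congr_ae ?_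
  filter_upwards [h1, h.selection i] with ω h3 h4
  rw [h3, Pi.mul_apply, h4]

theorem integral_inclusion (h : IsPoissonSample P y incl A) (i : Fin N) :
    ∫ ω, inclusion A i ω ∂P = ∫ ω, incl i ω ∂P := by
  simpa using h.integral_term (g := fun _ => 1) (M := 1) measurable_const
    (fun i => Eventually.of_forall fun ω => by simp) i

/-- The squared indicator is the indicator itself, so the bound is proportional to the mean
inclusion probability and sums to `M² n₀` rather than `M² N`. -/
theorem variance_term_le (h : IsPoissonSample P y incl A) (hg : Measurable g)
    (hb : ∀ i, ∀ᵐ ω ∂P, |g (y i ω, incl i ω)| ≤ M) (i : Fin N) :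
    Var[fun ω => g (y i ω, incl i ω) * inclusion A i ω; P] ≤ M ^ 2 * ∫ ω, incl i ω ∂P := by
  refine (variance_le_expectation_sq (h.measurable_term hg i).aestronglyMeasurable).trans ?_
  rw [← h.integral_inclusion i, ← integral_const_mul]
  refine integral_mono_ae (h.memLp_term hg hb i).integrable_sq
    ((Integrable.of_bound (h.measurable_sample i).aestronglyMeasurable 1
      (Eventually.of_forall fun ω => abs_inclusion_le A i ω)).const_mul _) ?_
  filter_upwards [hb i] with ω hω
  rcases inclusion_mem A i ω with h0 | h0
  · simp [h0]
  · simp only [Pi.pow_apply, h0, mul_one]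
    exact sq_le_sq' (abs_le.1 hω).1 (abs_le.1 hω).2

/-- Chebyshev's inequality for a sum over a Poisson sample. -/
theorem measure_sum_sub_ge_le (h : IsPoissonSample P y incl A) (hg : Measurable g)
    (hb : ∀ i, ∀ᵐ ω ∂P, |g (y i ω, incl i ω)| ≤ M) {ε : ℝ} (hε : 0 < ε) :
    P {ω | ε ≤ |∑ i ∈ A ω, g (y i ω, incl i ω) - ∑ i, ∫ ω, g (y i ω, incl i ω) * incl i ω ∂P|} ≤
      ENNReal.ofReal (M ^ 2 * expectedSize P incl / ε ^ 2) := by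
  have hmem := fun i => h.memLp_term hg hb i
  have hsum : MemLp (∑ i, fun ω => g (y i ω, incl i ω) * inclusion A i ω) 2 P :=
    memLp_finsetSum' _ fun i _ => hmem i
  have hE : ∫ ω, (∑ i, fun ω => g (y i ω, incl i ω) * inclusion A i ω) ω ∂P =
      ∑ i, ∫ ω, g (y i ω, incl i ω) * incl i ω ∂P := by
    simp only [Finset.sum_apply]
    rw [integral_finsetSum _ fun i _ => (hmem i).integrable one_le_two]
    exact Finset.sum_congr rfl fun i _ => h.integral_term hg hb i
  have hcheb := meas_ge_le_variance_div_sq hsum hε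
  rw [hE] at hcheb
  have hset : ∀ ω, ∑ i ∈ A ω, g (y i ω, incl i ω) =
      (∑ i, fun ω => g (y i ω, incl i ω) * inclusion A i ω) ω := fun ω => by
    rw [sum_sample_eq A (fun i => g (y i ω, incl i ω)) ω, Finset.sum_apply]
  simp only [hset]
  refine hcheb.trans (ENNReal.ofReal_le_ofReal ?_)
  gcongr
  rw [IndepFun.variance_sum (fun i _ => hmem i)
    (fun i _ j _ hij => (h.iIndepFun_term hg).indepFun hij), expectedSize, Finset.mul_sum]
  exact Finset.sum_le_sum fun i _ => h.variance_term_le hg hb i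

/-- The covariance of two sums over a Poisson sample. -/
theorem covariance_sum (h : IsPoissonSample P y incl A) (hg : Measurable g)
    (hb : ∀ i, ∀ᵐ ω ∂P, |g (y i ω, incl i ω)| ≤ M) (hg' : Measurable g')
    (hb' : ∀ i, ∀ᵐ ω ∂P, |g' (y i ω, incl i ω)| ≤ M') :
    cov[fun ω => ∑ i ∈ A ω, g (y i ω, incl i ω), fun ω => ∑ i ∈ A ω, g' (y i ω, incl i ω); P] =
      ∑ i, ∫ ω, g (y i ω, incl i ω) * g' (y i ω, incl i ω) * incl i ω ∂P -
        ∑ i, (∫ ω, g (y i ω, incl i ω) * incl i ω ∂P) *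
          ∫ ω, g' (y i ω, incl i ω) * incl i ω ∂P := by
  have e : ∀ (f : K × ℝ → ℝ), (fun ω => ∑ i ∈ A ω, f (y i ω, incl i ω)) =
      fun ω => ∑ i, f (y i ω, incl i ω) * inclusion A i ω := fun f =>
    funext fun ω => sum_sample_eq A (fun i => f (y i ω, incl i ω)) ω
  rw [e g, e g', covariance_fun_sum_fun_sum (fun i => h.memLp_term hg hb i)
    (fun i => h.memLp_term hg' hb' i), ← Finset.sum_sub_distrib]
  refine Finset.sum_congr rfl fun i _ => ?_
  -- Distinct units are independent, so only the diagonal covariances survive.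
  rw [Finset.sum_eq_single i]
  · rw [covariance_eq_sub (h.memLp_term hg hb i) (h.memLp_term hg' hb' i),
      h.integral_term hg hb i, h.integral_term hg' hb' i]
    congr 1
    have hbb : ∀ i, ∀ᵐ ω ∂P, |(fun x => g x * g' x) (y i ω, incl i ω)| ≤ M * M' := fun i => by
      filter_upwards [hb i, hb' i] with ω h1 h2
      rw [abs_mul]
      exact mul_le_mul h1 h2 (abs_nonneg _) ((abs_nonneg _).trans h1)
    refine Eq.trans ?_ (h.integral_term (g := fun x => g x * g' x) (hg.mul hg') hbb i)
    refine integral_congr_ae (Eventually.of_forall fun ω => ?_)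
    rcases inclusion_mem A i ω with h0 | h0 <;> simp [h0]
  · intro j _ hji
    have hind : IndepFun (fun ω => g (y i ω, incl i ω) * inclusion A i ω)
        (fun ω => g' (y j ω, incl j ω) * inclusion A j ω) P :=
      (h.indep.indepFun hji.symm).comp
        (φ := fun x : K × ℝ × ℝ => g (x.1, x.2.1) * x.2.2)
        (ψ := fun x : K × ℝ × ℝ => g' (x.1, x.2.1) * x.2.2) (by fun_prop) (by fun_prop)
    exact hind.covariance_eq_zero (h.memLp_term hg hb i) (h.memLp_term hg' hb' j)
  · exact fun hi => absurd (Finset.mem_univ i) hi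

end IsPoissonSample

end PoissonSampling

/-! ### Unit contributions to the weighted score. -/

section ScoreTerm

variable {r c : ℕ}

theorem measurable_cell_ite (a : Cell r c) (s t : ℝ) :
    Measurable fun x : Cell r c × ℝ => if x.1 = a then s else t :=
  Measurable.ite (measurable_fst (measurableSet_singleton a)) measurable_const measurable_const

/-- The contribution of a sampled unit to the weighted score. -/
noncomputable def scoreTerm (p : Cell r c → ℝ) (N : ℕ) (a : Cell r c) (x : Cell r c × ℝ) : ℝ :=
  x.2⁻¹ * ((if x.1 = a then 1 else 0) - p a) / N

theorem measurable_scoreTerm (p : Cell r c → ℝ) (N : ℕ) (a : Cell r c) :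
    Measurable (scoreTerm p N a) :=
  (measurable_snd.inv.mul ((measurable_cell_ite a 1 0).sub_const _)).div_const _

theorem weightedScore_eq {Ω : Type*} {N : ℕ} (p : Cell r c → ℝ) (y : Fin N → Ω → Cell r c)
    (incl : Fin N → Ω → ℝ) (A : Ω → Finset (Fin N)) (a : Cell r c) :
    weightedScore p y incl A a =
      fun ω => ∑ i ∈ A ω, scoreTerm p (N) a (y i ω, incl i ω) := by
  funext ω
  simp only [weightedScore, scoreTerm, Finset.sum_div]

theorem abs_ite_sub_le (p : Cell r c → ℝ) (k a : Cell r c) : |(if k = a then (1 : ℝ) else 0) - p a| ≤ 1 + |p a| := by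
  refine (abs_sub _ _).trans (add_le_add ?_ le_rfl)
  split_ifs <;> simp

end ScoreTerm

/-! ### Laws of large numbers for the size, weighted means and second moments of the sample. -/

section PoissonDesigns

/-- A sequence of Poisson samples with expected sample size of smaller order than the population
size and inclusion probabilities bounded below by a multiple of their average order. -/
structure PoissonDesigns {K : Type*} [MeasurableSpace K] {Ω : ℕ → Type*}
    [∀ ν, MeasurableSpace (Ω ν)] (P : ∀ ν, Measure (Ω ν)) (N : ℕ → ℕ)
    (y : ∀ ν, Fin (N ν) → Ω ν → K) (incl : ∀ ν, Fin (N ν) → Ω ν → ℝ)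
    (A : ∀ ν, Ω ν → Finset (Fin (N ν))) (C₁ : ℝ) : Prop where
  sample : ∀ ν, IsPoissonSample (P ν) (y ν) (incl ν) (A ν)
  size : Tendsto (fun ν => expectedSize (P ν) (incl ν)) atTop atTop
  fraction : Tendsto (fun ν => expectedSize (P ν) (incl ν) / N ν) atTop (𝓝 0)
  const_pos : 0 < C₁
  lower : ∀ ν i, ∀ᵐ ω ∂(P ν), C₁ ≤ N ν / expectedSize (P ν) (incl ν) * incl ν i ω

namespace PoissonDesigns

section General

variable {K : Type*} [MeasurableSpace K] {Ω : ℕ → Type*} [∀ ν, MeasurableSpace (Ω ν)]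
  {P : ∀ ν, Measure (Ω ν)} {N : ℕ → ℕ} {y : ∀ ν, Fin (N ν) → Ω ν → K}
  {incl : ∀ ν, Fin (N ν) → Ω ν → ℝ} {A : ∀ ν, Ω ν → Finset (Fin (N ν))} {C₁ : ℝ}

theorem eventually_pos (h : PoissonDesigns P N y incl A C₁) :
    ∀ᶠ ν in atTop, 0 < expectedSize (P ν) (incl ν) ∧ (0 : ℝ) < N ν ∧
      ∀ i, ∀ᵐ ω ∂(P ν), 0 < incl ν i ω ∧
        (incl ν i ω)⁻¹ ≤ N ν / (C₁ * expectedSize (P ν) (incl ν)) := by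
  have hC₁ := h.const_pos
  filter_upwards [h.size.eventually_gt_atTop 0] with ν hν
  have hN : N ν ≠ 0 := fun h0 => by
    have : IsEmpty (Fin (N ν)) := by rw [h0]; infer_instance
    simp [expectedSize] at hν
  have hN' : (0 : ℝ) < N ν := by exact_mod_cast Nat.pos_of_ne_zero hN
  refine ⟨hν, hN', fun i => ?_⟩
  filter_upwards [h.lower ν i] with ω hω
  have hpos : 0 < incl ν i ω := by
    by_contra hneg
    have : N ν / expectedSize (P ν) (incl ν) * incl ν i ω ≤ 0 :=
      mul_nonpos_of_nonneg_of_nonpos (by positivity) (not_lt.1 hneg)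
    linarith
  refine ⟨hpos, ?_⟩
  rw [inv_le_comm₀ hpos (by positivity), inv_div, div_le_iff₀ hN']
  calc C₁ * expectedSize (P ν) (incl ν)
      ≤ N ν / expectedSize (P ν) (incl ν) * incl ν i ω * expectedSize (P ν) (incl ν) := by gcongr
    _ = incl ν i ω * N ν := by field_simp

variable [∀ ν, IsProbabilityMeasure (P ν)]

/-- A weak law of large numbers for sums over the sample. -/
theorem tendsto_measure_sum_notMem (h : PoissonDesigns P N y incl A C₁)
    {g : ℕ → K × ℝ → ℝ} (hg : ∀ ν, Measurable (g ν)) {M : ℕ → ℝ}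
    (hb : ∀ᶠ ν in atTop, ∀ i, ∀ᵐ ω ∂(P ν), |g ν (y ν i ω, incl ν i ω)| ≤ M ν)
    (hM : Tendsto (fun ν => M ν ^ 2 * expectedSize (P ν) (incl ν)) atTop (𝓝 0)) {L : ℝ}
    (hL : Tendsto (fun ν => ∑ i, ∫ ω, g ν (y ν i ω, incl ν i ω) * incl ν i ω ∂(P ν)) atTop (𝓝 L))
    {V : Set ℝ} (hV : V ∈ 𝓝 L) :
    Tendsto (fun ν => P ν {ω | ∑ i ∈ A ν ω, g ν (y ν i ω, incl ν i ω) ∉ V}) atTop (𝓝 0) := by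
  obtain ⟨ε, hε, hball⟩ := Metric.mem_nhds_iff.1 hV
  have hlim : Tendsto (fun ν => ENNReal.ofReal
      (M ν ^ 2 * expectedSize (P ν) (incl ν) / (ε / 2) ^ 2)) atTop (𝓝 0) := by
    have := ENNReal.tendsto_ofReal (hM.div_const ((ε / 2) ^ 2))
    simpa using this
  refine tendsto_of_tendsto_of_tendsto_of_le_of_le' tendsto_const_nhds hlim
    (Eventually.of_forall fun _ => zero_le) ?_
  filter_upwards [hb, hL.eventually (Metric.ball_mem_nhds L (half_pos hε))] with ν hν hm
  refine (measure_mono fun ω hω => ?_).trans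
    ((h.sample ν).measure_sum_sub_ge_le (hg ν) hν (half_pos hε))
  simp only [Set.mem_ofPred_eq] at hω ⊢
  by_contra hlt
  refine hω (hball ?_)
  rw [Metric.mem_ball, Real.dist_eq]
  rw [Real.dist_eq] at hm
  calc _ ≤ _ := abs_sub_le _ (∑ i, ∫ ω, g ν (y ν i ω, incl ν i ω) * incl ν i ω ∂(P ν)) _
    _ < ε := by linarith [not_le.1 hlt]

theorem tendsto_measure_card (h : PoissonDesigns P N y incl A C₁) {V : Set ℝ} (hV : V ∈ 𝓝 1) :
    Tendsto (fun ν => P ν {ω | ((A ν ω).card : ℝ) / expectedSize (P ν) (incl ν) ∉ V}) atTop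
      (𝓝 0) := by
  have key := h.tendsto_measure_sum_notMem (g := fun ν _ => (expectedSize (P ν) (incl ν))⁻¹)
    (M := fun ν => (expectedSize (P ν) (incl ν))⁻¹) (L := 1) (fun ν => measurable_const) ?_ ?_ ?_ hV
  · simpa only [Finset.sum_const, nsmul_eq_mul, ← div_eq_mul_inv] using key
  · filter_upwards [h.size.eventually_gt_atTop 0] with ν hν i
    exact Eventually.of_forall fun ω => (abs_of_pos (inv_pos.2 hν)).le
  · refine (tendsto_inv_atTop_zero.comp h.size).congr' ?_
    filter_upwards [h.size.eventually_gt_atTop 0] with ν hν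
    simp only [Function.comp_apply]
    field_simp
  · refine tendsto_const_nhds.congr' ?_
    filter_upwards [h.size.eventually_gt_atTop 0] with ν hν
    simp only [integral_const_mul]
    rw [← Finset.mul_sum]
    exact (inv_mul_cancel₀ hν.ne').symm

end General

section Cells

variable {r c : ℕ} {Ω : ℕ → Type*} [∀ ν, MeasurableSpace (Ω ν)]
  {P : ∀ ν, Measure (Ω ν)} {N : ℕ → ℕ}
  {y : ∀ ν, Fin (N ν) → Ω ν → Cell r c}
  {incl : ∀ ν, Fin (N ν) → Ω ν → ℝ} {A : ∀ ν, Ω ν → Finset (Fin (N ν))} {C₁ : ℝ}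
  {p : Cell r c → ℝ}

theorem eventually_scoreTerm_le (h : PoissonDesigns P N y incl A C₁) (a : Cell r c) :
    ∀ᶠ ν in atTop, ∀ i, ∀ᵐ ω ∂(P ν), |scoreTerm p (N ν) a (y ν i ω, incl ν i ω)| ≤
      (1 + |p a|) / (C₁ * expectedSize (P ν) (incl ν)) := by
  have hC₁ := h.const_pos
  filter_upwards [h.eventually_pos] with ν ⟨hn, hN, hi⟩ i
  filter_upwards [hi i] with ω ⟨h1, h2⟩
  rw [scoreTerm, abs_div, abs_mul, abs_of_pos hN, abs_of_pos (inv_pos.2 h1), div_le_iff₀ hN]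
  calc _ ≤ N ν / (C₁ * expectedSize (P ν) (incl ν)) * (1 + |p a|) :=
        mul_le_mul h2 (abs_ite_sub_le _ _ _) (abs_nonneg _) (by positivity)
    _ = _ := by ring

variable [∀ ν, IsProbabilityMeasure (P ν)]

/-- Weight times inclusion probability is 1, so the expectation is the average cell probability. The
terms are `O(1 / n₀)`, which makes the variance `O(1 / n₀)`. -/
theorem tendsto_measure_mean (h : PoissonDesigns P N y incl A C₁)
    (hp : ∀ a, Tendsto (fun ν => (∑ i, (P ν).real {ω | y ν i ω = a}) / N ν) atTop (𝓝 (p a)))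
    (a : Cell r c) {V : Set ℝ} (hV : V ∈ 𝓝 (p a)) :
    Tendsto (fun ν => P ν {ω | (∑ i ∈ A ν ω, if y ν i ω = a then (incl ν i ω)⁻¹ else 0) / N ν ∉ V})
      atTop (𝓝 0) := by
  have hC₁ := h.const_pos
  have key := h.tendsto_measure_sum_notMem
    (g := fun ν x => (if x.1 = a then (1 : ℝ) else 0) * x.2⁻¹ / N ν)
    (M := fun ν => (C₁ * expectedSize (P ν) (incl ν))⁻¹) (L := p a)
    (fun ν => ((measurable_cell_ite a 1 0).mul measurable_snd.inv).div_const _) ?_ ?_ ?_ hV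
  · simpa only [← Finset.sum_div, ite_mul, one_mul, zero_mul] using key
  · filter_upwards [h.eventually_pos] with ν ⟨hn, hN, hi⟩ i
    filter_upwards [hi i] with ω ⟨h1, h2⟩
    have h3 : |(if y ν i ω = a then (1 : ℝ) else 0)| ≤ 1 := by split_ifs <;> simp
    rw [abs_div, abs_mul, abs_of_pos hN, abs_of_pos (inv_pos.2 h1), div_le_iff₀ hN]
    calc _ ≤ 1 * (N ν / (C₁ * expectedSize (P ν) (incl ν))) :=
          mul_le_mul h3 h2 (inv_pos.2 h1).le zero_le_one
      _ = _ := by ring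
  · have := (tendsto_inv_atTop_zero.comp h.size).const_mul ((C₁ ^ 2)⁻¹)
    rw [mul_zero] at this
    refine this.congr' ?_
    filter_upwards [h.size.eventually_gt_atTop 0] with ν hν
    simp only [Function.comp_apply]
    field_simp
  · refine (hp a).congr' ?_
    filter_upwards [h.eventually_pos] with ν ⟨hn, hN, hi⟩
    rw [Finset.sum_div]
    refine Finset.sum_congr rfl fun i _ => ?_
    have hmeas : MeasurableSet {ω | y ν i ω = a} :=
      (h.sample ν).measurable_cat i (measurableSet_singleton a)
    rw [← integral_indicator_one hmeas, ← integral_div]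
    refine integral_congr_ae ?_
    filter_upwards [hi i] with ω ⟨h1, _⟩
    simp only [Set.indicator_apply, Set.mem_ofPred_eq, Pi.one_apply]
    split_ifs
    · field_simp
    · simp

/-- The inclusion probability cancels the weight, so means are `O(1 / N)` although sampled terms are
only `O(1 / n₀)`. -/
theorem eventually_integral_scoreTerm_le (h : PoissonDesigns P N y incl A C₁) (a : Cell r c) :
    ∀ᶠ ν in atTop, ∀ i,
      |∫ ω, scoreTerm p (N ν) a (y ν i ω, incl ν i ω) * incl ν i ω ∂(P ν)| ≤
        (1 + |p a|) / N ν := by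
  filter_upwards [h.eventually_pos] with ν ⟨hn, hN, hi⟩ i
  have := norm_integral_le_of_norm_le_const (μ := P ν) (C := (1 + |p a|) / N ν)
    (f := fun ω => scoreTerm p (N ν) a (y ν i ω, incl ν i ω) * incl ν i ω) ?_
  · simpa using this
  · filter_upwards [hi i] with ω ⟨h1, _⟩
    have e : scoreTerm p (N ν) a (y ν i ω, incl ν i ω) * incl ν i ω =
        ((if y ν i ω = a then 1 else 0) - p a) / N ν := by
      rw [scoreTerm]
      field_simp
    rw [e, norm_div, Real.norm_eq_abs, Real.norm_eq_abs, abs_of_pos hN]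
    exact div_le_div_of_nonneg_right (abs_ite_sub_le _ _ _) hN.le

variable {Sp : Matrix (FreeCell r c) (FreeCell r c) ℝ}

/-- The covariance differs from the sum of second moments by `N` products of means, each `O(N⁻²)`.
After scaling by `n₀` this is `O(n₀ / N)`, where the vanishing sampling fraction enters. -/
theorem tendsto_mean_second (h : PoissonDesigns P N y incl A C₁)
    (hSp : ∀ a b : FreeCell r c,
      Tendsto (fun ν => expectedSize (P ν) (incl ν) *
        cov[weightedScore p (y ν) (incl ν) (A ν) a.1,
          weightedScore p (y ν) (incl ν) (A ν) b.1; P ν]) atTop (𝓝 (Sp a b)))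
    (a b : FreeCell r c) :
    Tendsto (fun ν => expectedSize (P ν) (incl ν) * ∑ i, ∫ ω,
      scoreTerm p (N ν) a.1 (y ν i ω, incl ν i ω) * scoreTerm p (N ν) b.1 (y ν i ω, incl ν i ω) *
        incl ν i ω ∂(P ν)) atTop (𝓝 (Sp a b)) := by
  have herr : Tendsto (fun ν => expectedSize (P ν) (incl ν) * ∑ i,
      (∫ ω, scoreTerm p (N ν) a.1 (y ν i ω, incl ν i ω) * incl ν i ω ∂(P ν)) *
        ∫ ω, scoreTerm p (N ν) b.1 (y ν i ω, incl ν i ω) * incl ν i ω ∂(P ν)) atTop (𝓝 0) := by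
    have hlim := h.fraction.const_mul ((1 + |p a.1|) * (1 + |p b.1|))
    rw [mul_zero] at hlim
    refine squeeze_zero_norm' ?_ hlim
    filter_upwards [h.eventually_pos, h.eventually_integral_scoreTerm_le a.1 (p := p),
      h.eventually_integral_scoreTerm_le b.1 (p := p)] with ν ⟨hn, hN, _⟩ h1 h2
    rw [norm_mul, Real.norm_eq_abs, abs_of_pos hn]
    calc _ ≤ expectedSize (P ν) (incl ν) *
          ∑ _i : Fin (N ν), (1 + |p a.1|) / N ν * ((1 + |p b.1|) / N ν) := by
          refine mul_le_mul_of_nonneg_left ((norm_sum_le _ _).trans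
            (Finset.sum_le_sum fun i _ => ?_)) hn.le
          rw [norm_mul]
          exact mul_le_mul (h1 i) (h2 i) (norm_nonneg _) (by positivity)
      _ = _ := by
          rw [Finset.sum_const, Finset.card_univ, Fintype.card_fin, nsmul_eq_mul]
          field_simp
  have := (hSp a b).add herr
  rw [add_zero] at this
  refine this.congr' ?_
  filter_upwards [h.eventually_scoreTerm_le a.1 (p := p), h.eventually_scoreTerm_le b.1 (p := p)]
    with ν h1 h2
  rw [weightedScore_eq, weightedScore_eq, (h.sample ν).covariance_sum (measurable_scoreTerm _ _ _)
    h1 (measurable_scoreTerm _ _ _) h2]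
  ring

theorem tendsto_measure_second (h : PoissonDesigns P N y incl A C₁)
    (hSp : ∀ a b : FreeCell r c,
      Tendsto (fun ν => expectedSize (P ν) (incl ν) *
        cov[weightedScore p (y ν) (incl ν) (A ν) a.1,
          weightedScore p (y ν) (incl ν) (A ν) b.1; P ν]) atTop (𝓝 (Sp a b)))
    (a b : FreeCell r c) {V : Set ℝ} (hV : V ∈ 𝓝 (Sp a b)) :
    Tendsto (fun ν => P ν {ω | expectedSize (P ν) (incl ν) / (N ν : ℝ) ^ 2 * ∑ i ∈ A ν ω,
      (incl ν i ω)⁻¹ ^ 2 * ((if y ν i ω = a.1 then 1 else 0) - p a.1) *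
        ((if y ν i ω = b.1 then 1 else 0) - p b.1) ∉ V}) atTop (𝓝 0) := by
  have hC₁ := h.const_pos
  have key := h.tendsto_measure_sum_notMem (V := V)
    (g := fun ν x => expectedSize (P ν) (incl ν) *
      (scoreTerm p (N ν) a.1 x * scoreTerm p (N ν) b.1 x))
    (M := fun ν => expectedSize (P ν) (incl ν) *
      ((1 + |p a.1|) / (C₁ * expectedSize (P ν) (incl ν)) *
        ((1 + |p b.1|) / (C₁ * expectedSize (P ν) (incl ν)))))
    (fun ν => ((measurable_scoreTerm _ _ _).mul (measurable_scoreTerm _ _ _)).const_mul _)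
    ?_ ?_ ?_ hV
  · refine key.congr fun ν => ?_
    congr 2
    ext ω
    rw [Finset.mul_sum]
    refine not_congr (iff_of_eq (congrArg (· ∈ V) (Finset.sum_congr rfl fun i _ => ?_)))
    simp only [scoreTerm]
    ring
  · filter_upwards [h.eventually_pos, h.eventually_scoreTerm_le a.1 (p := p),
      h.eventually_scoreTerm_le b.1 (p := p)] with ν ⟨hn, hN, _⟩ h1 h2 i
    filter_upwards [h1 i, h2 i] with ω h3 h4
    rw [abs_mul, abs_mul, abs_of_pos hn]
    exact mul_le_mul_of_nonneg_left (mul_le_mul h3 h4 (abs_nonneg _) (by positivity)) hn.le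
  · have := (tendsto_inv_atTop_zero.comp h.size).const_mul
      (((1 + |p a.1|) * (1 + |p b.1|) / C₁ ^ 2) ^ 2)
    rw [mul_zero] at this
    refine this.congr' ?_
    filter_upwards [h.size.eventually_gt_atTop 0] with ν hν
    simp only [Function.comp_apply]
    field_simp
  · refine (h.tendsto_mean_second hSp a b).congr fun ν => ?_
    rw [Finset.mul_sum]
    refine Finset.sum_congr rfl fun i _ => ?_
    rw [← integral_const_mul]
    simp only [mul_assoc]

/-- The quadratic form of the limit is a limit of nonnegative multiples of variances of linear
combinations of scores. Semidefiniteness is what gives meaning to the Gaussian limit. -/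
theorem posSemidef_limit (h : PoissonDesigns P N y incl A C₁)
    (hSp : ∀ a b : FreeCell r c,
      Tendsto (fun ν => expectedSize (P ν) (incl ν) *
        cov[weightedScore p (y ν) (incl ν) (A ν) a.1,
          weightedScore p (y ν) (incl ν) (A ν) b.1; P ν]) atTop (𝓝 (Sp a b))) :
    Sp.PosSemidef := by
  rw [Matrix.posSemidef_iff_dotProduct_mulVec]
  refine ⟨?_, fun x => ?_⟩
  · ext a b
    rw [Matrix.conjTranspose_apply, star_trivial]
    refine tendsto_nhds_unique (hSp b a) ((hSp a b).congr fun ν => ?_)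
    rw [covariance_comm]
  · have hlim := tendsto_finsetSum Finset.univ fun (a : FreeCell r c) _ =>
      tendsto_finsetSum Finset.univ fun (b : FreeCell r c) _ => (hSp a b).const_mul (x a * x b)
    have e : star x ⬝ᵥ Sp.mulVec x = ∑ a, ∑ b, x a * x b * Sp a b := by
      simp only [dotProduct, Matrix.mulVec, star_trivial, Finset.mul_sum]
      exact Finset.sum_congr rfl fun a _ => Finset.sum_congr rfl fun b _ => by ring
    rw [e]
    refine ge_of_tendsto hlim ?_
    have hall : ∀ᶠ ν in atTop, ∀ a : Cell r c, ∀ i, ∀ᵐ ω ∂(P ν),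
        |scoreTerm p (N ν) a (y ν i ω, incl ν i ω)| ≤
          (1 + |p a|) / (C₁ * expectedSize (P ν) (incl ν)) :=
      eventually_all.2 fun a => h.eventually_scoreTerm_le a
    filter_upwards [h.size.eventually_ge_atTop 0, hall] with ν hn hν
    have hmem : ∀ a : FreeCell r c,
        MemLp (fun ω => x a * weightedScore p (y ν) (incl ν) (A ν) a.1 ω) 2 (P ν) := fun a => by
      have : MemLp (fun ω => ∑ i, scoreTerm p (N ν) a.1 (y ν i ω, incl ν i ω) *
          inclusion (A ν) i ω) 2 (P ν) := memLp_finsetSum _ fun i _ =>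
        (h.sample ν).memLp_term (measurable_scoreTerm _ _ _) (hν a.1) i
      refine MemLp.const_mul ?_ (x a)
      rw [weightedScore_eq]
      convert! this using 2 with ω
      exact sum_sample_eq (A ν) (fun i => scoreTerm p (N ν) a.1 (y ν i ω, incl ν i ω)) ω
    have hvar := covariance_fun_sum_fun_sum hmem hmem
    simp only [covariance_const_mul_left, covariance_const_mul_right] at hvar
    have hnn : 0 ≤ cov[fun ω => ∑ a : FreeCell r c, x a *
        weightedScore p (y ν) (incl ν) (A ν) a.1 ω, fun ω => ∑ a : FreeCell r c, x a *
        weightedScore p (y ν) (incl ν) (A ν) a.1 ω; P ν] := by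
      rw [covariance_self (memLp_finsetSum _ fun a _ => hmem a).aemeasurable]
      exact variance_nonneg _ _
    rw [hvar] at hnn
    have := mul_nonneg hn hnn
    simp only [Finset.mul_sum] at this
    refine this.trans_eq (Finset.sum_congr rfl fun a _ => Finset.sum_congr rfl fun b _ => ?_)
    ring

end Cells

end PoissonDesigns

end PoissonDesigns

/-! ### From sequences of outcomes to convergence in probability. -/

/-- Transfer from almost sure limits along sequences of outcomes to limits in probability: if `Φ`
converges along every sequence of good outcomes on which finitely many statistics converge, then it
converges in probability as soon as these statistics do. -/
theorem tendsto_measure_of_forall_seq {Ω : ℕ → Type*} [∀ ν, MeasurableSpace (Ω ν)]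
    {P : ∀ ν, Measure (Ω ν)} {κ : Type*} [Fintype κ] {X : κ → ∀ ν, Ω ν → ℝ} {L : κ → ℝ}
    {good : ∀ ν, Set (Ω ν)} (hgood : ∀ ν, P ν (good ν)ᶜ = 0)
    (hX : ∀ k, ∀ V ∈ 𝓝 (L k), Tendsto (fun ν => P ν {ω | X k ν ω ∉ V}) atTop (𝓝 0))
    {Φ : ∀ ν, Ω ν → ℝ} {b : ℝ}
    (hseq : ∀ u : ℕ → Σ ν, Ω ν, Tendsto (fun j => (u j).1) atTop atTop →
      (∀ k, Tendsto (fun j => X k (u j).1 (u j).2) atTop (𝓝 (L k))) →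
      (∀ᶠ j in atTop, (u j).2 ∈ good (u j).1) →
      Tendsto (fun j => Φ (u j).1 (u j).2) atTop (𝓝 b)) {ε : ℝ} (hε : 0 < ε) :
    Tendsto (fun ν => P ν {ω | ε ≤ |Φ ν ω - b|}) atTop (𝓝 0) := by
  -- This filter on pairs of index and outcome encodes all hypotheses on a sequence. It is countably
  -- generated, so limits along sequences give a limit along `l`. A member of `l` then bounds the
  -- bad event by finitely many exceptional events.
  set l : Filter (Σ ν, Ω ν) := (comap Sigma.fst atTop ⊓
    comap (fun j k => X k j.1 j.2) (𝓝 L)) ⊓ 𝓟 {j | j.2 ∈ good j.1} with hl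
  have hlim : Tendsto (fun j : Σ ν, Ω ν => Φ j.1 j.2) l (𝓝 b) := by
    refine tendsto_of_seq_tendsto fun u hu => ?_
    rw [hl, tendsto_inf, tendsto_inf, tendsto_comap_iff, tendsto_comap_iff, tendsto_principal] at hu
    exact hseq u hu.1.1 (tendsto_pi_nhds.1 hu.1.2) hu.2
  have hmem := hlim (Metric.ball_mem_nhds b hε)
  rw [mem_map, hl, mem_inf_principal, mem_inf_iff_superset] at hmem
  obtain ⟨s, ⟨s', hs', hs⟩, t, ⟨t', ht', ht⟩, hst⟩ := hmem
  obtain ⟨ν₀, hν₀⟩ := mem_atTop_sets.1 hs'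
  rw [nhds_pi, Filter.mem_pi'] at ht'
  obtain ⟨I, V, hV, hVt⟩ := ht'
  have hsum : Tendsto (fun ν => ∑ k, P ν {ω | X k ν ω ∉ V k}) atTop (𝓝 0) := by
    simpa using tendsto_finsetSum Finset.univ fun k _ => hX k (V k) (hV k)
  refine tendsto_of_tendsto_of_tendsto_of_le_of_le' tendsto_const_nhds hsum
    (Eventually.of_forall fun _ => zero_le) ?_
  filter_upwards [eventually_ge_atTop ν₀] with ν hν
  have hsub : {ω | ε ≤ |Φ ν ω - b|} ⊆ (good ν)ᶜ ∪ ⋃ k, {ω | X k ν ω ∉ V k} := by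
    intro ω hω
    by_contra hnot
    simp only [Set.mem_union, Set.mem_compl_iff, Set.mem_iUnion, Set.mem_ofPred_eq, not_or, not_not,
      not_exists] at hnot
    have h1 : (⟨ν, ω⟩ : Σ ν, Ω ν) ∈ s ∩ t :=
      ⟨hs (hν₀ ν hν), ht (hVt fun k _ => hnot.2 k)⟩
    have h2 := hst h1 hnot.1
    simp only [Set.mem_preimage, Metric.mem_ball, Real.dist_eq] at h2
    exact absurd hω (not_le.2 h2)
  calc P ν {ω | ε ≤ |Φ ν ω - b|} ≤ P ν (good ν)ᶜ + P ν (⋃ k, {ω | X k ν ω ∉ V k}) :=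
        (measure_mono hsub).trans (measure_union_le _ _)
    _ ≤ ∑ k, P ν {ω | X k ν ω ∉ V k} := by
        rw [hgood, zero_add]
        exact measure_iUnion_fintype_le _ _

/-! ### Assembly. -/

section Main

variable {r c : ℕ} {Ω : ℕ → Type*} [∀ ν, MeasurableSpace (Ω ν)]
  {P : ∀ ν, Measure (Ω ν)} [∀ ν, IsProbabilityMeasure (P ν)] {N : ℕ → ℕ}
  {y : ∀ ν, Fin (N ν) → Ω ν → Cell r c}
  {incl : ∀ ν, Fin (N ν) → Ω ν → ℝ} {A : ∀ ν, Ω ν → Finset (Fin (N ν))} {C₁ C₂ : ℝ}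
  {p : Cell r c → ℝ} {Sp : Matrix (FreeCell r c) (FreeCell r c) ℝ}

namespace PoissonDesigns

theorem sum_limit_eq_one (h : PoissonDesigns P N y incl A C₁)
    (hp : ∀ a, Tendsto (fun ν => (∑ i, (P ν).real {ω | y ν i ω = a}) / N ν) atTop (𝓝 (p a))) :
    ∑ a, p a = 1 := by
  refine tendsto_nhds_unique (tendsto_finsetSum Finset.univ fun a _ => hp a)
    (tendsto_const_nhds.congr' ?_)
  filter_upwards [h.eventually_pos] with ν ⟨_, hN, _⟩
  have h1 : ∀ i, ∑ a, (P ν).real {ω | y ν i ω = a} = 1 := fun i => by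
    have := sum_measureReal_preimage_singleton (μ := P ν) (f := y ν i) Finset.univ
      fun a _ => (h.sample ν).measurable_cat i (measurableSet_singleton a)
    simp only [Finset.coe_univ, Set.preimage_univ, probReal_univ] at this
    exact this
  rw [← Finset.sum_div, Finset.sum_comm, Finset.sum_congr rfl fun i _ => h1 i]
  simp [hN.ne']

theorem tendstoConditionally (h : PoissonDesigns P N y incl A C₁)
    (hupper : ∀ ν i, ∀ᵐ ω ∂(P ν), N ν / expectedSize (P ν) (incl ν) * incl ν i ω ≤ C₂)
    (hp : ∀ a, Tendsto (fun ν => (∑ i, (P ν).real {ω | y ν i ω = a}) / N ν) atTop (𝓝 (p a)))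
    (hSp : ∀ a b : FreeCell r c,
      Tendsto (fun ν => expectedSize (P ν) (incl ν) *
        cov[weightedScore p (y ν) (incl ν) (A ν) a.1,
          weightedScore p (y ν) (incl ν) (A ν) b.1; P ν]) atTop (𝓝 (Sp a b)))
    {T : ℝ → (Cell r c → ℝ) → (Cell r c → ℝ) → ℝ} (hTm : ∀ n q, Measurable (T n q))
    (hT : ∀ {l : Filter (ℕ × WithLp 2 (ℝ × EuclideanSpace ℝ (FreeCell r c)))}
      {n : ℕ × WithLp 2 (ℝ × EuclideanSpace ℝ (FreeCell r c)) → ℝ}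
      {q u : ℕ × WithLp 2 (ℝ × EuclideanSpace ℝ (FreeCell r c)) → Cell r c → ℝ}
      {u₀ : Cell r c → ℝ}, Tendsto n l atTop → Tendsto q l (𝓝 p) → Tendsto u l (𝓝 u₀) →
      Tendsto (fun k => T (n k) (q k) (q k + (√(n k))⁻¹ • u k)) l (𝓝 (chiForm p u₀))) :
    TendstoConditionally P
      (fun ν ω => bootStatLaw T (A ν ω) (fun i => incl ν i ω) (fun i => y ν i ω))
      ((multivariateGaussian 0 Sp).map fun s => chiForm p (tangent s.ofLp)) := by
  intro f ε hε
  have hSpsd := h.posSemidef_limit hSp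
  have hsum := h.sum_limit_eq_one hp
  -- The random quantities whose convergence `RegularSamples` demands: relative sample size,
  -- weighted cell means and weighted second moments. The almost sure bounds on the inclusion
  -- probabilities form the good event.
  set X : Unit ⊕ (Cell r c ⊕ FreeCell r c × FreeCell r c) → ∀ ν, Ω ν → ℝ := fun k ν ω =>
    match k with
    | Sum.inl _ => ((A ν ω).card : ℝ) / expectedSize (P ν) (incl ν)
    | Sum.inr (Sum.inl a) => (∑ i ∈ A ν ω, if y ν i ω = a then (incl ν i ω)⁻¹ else 0) / N ν
    | Sum.inr (Sum.inr ab) => expectedSize (P ν) (incl ν) / (N ν : ℝ) ^ 2 * ∑ i ∈ A ν ω,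
        (incl ν i ω)⁻¹ ^ 2 * ((if y ν i ω = ab.1.1 then 1 else 0) - p ab.1.1) *
          ((if y ν i ω = ab.2.1 then 1 else 0) - p ab.2.1) with hXdef
  set L : Unit ⊕ (Cell r c ⊕ FreeCell r c × FreeCell r c) → ℝ := fun k =>
    match k with
    | Sum.inl _ => 1
    | Sum.inr (Sum.inl a) => p a
    | Sum.inr (Sum.inr ab) => Sp ab.1 ab.2
  set good : ∀ ν, Set (Ω ν) := fun ν => {ω | ∀ i,
    C₁ ≤ N ν / expectedSize (P ν) (incl ν) * incl ν i ω ∧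
      N ν / expectedSize (P ν) (incl ν) * incl ν i ω ≤ C₂}
  have hgood : ∀ ν, P ν (good ν)ᶜ = 0 := fun ν =>
    ae_all_iff.2 fun i => (h.lower ν i).and (hupper ν i)
  refine tendsto_measure_of_forall_seq (X := X) (L := L) hgood ?_ ?_ hε
  · rintro (_ | a | ⟨a, b⟩) V hV
    · exact h.tendsto_measure_card hV
    · exact h.tendsto_measure_mean hp a hV
    · exact h.tendsto_measure_second hSp a b hV
  · intro u hu hXu hgu
    have hreg : RegularSamples p Sp C₁ C₂ (fun j => N (u j).1)
        (fun j => expectedSize (P (u j).1) (incl (u j).1)) (fun j => A (u j).1 (u j).2)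
        (fun j i => incl (u j).1 i (u j).2) (fun j i => y (u j).1 i (u j).2) :=
      { size := h.size.comp hu
        fraction := h.fraction.comp hu
        bounds := hgu
        card := hXu (Sum.inl ())
        mean := fun a => hXu (Sum.inr (Sum.inl a))
        second := fun a b => hXu (Sum.inr (Sum.inr (a, b))) }
    have hchi : Measurable fun s : EuclideanSpace ℝ (FreeCell r c) =>
        chiForm p (tangent s.ofLp) := (continuous_chiForm_tangent p).measurable
    rw [integral_map hchi.aemeasurable f.continuous.aestronglyMeasurable]
    exact hreg.tendsto_integral_bootStatLaw h.const_pos hsum hSpsd hTm hT f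

end PoissonDesigns

end Main

end SurveyTable

theorem theorem7 {r c : ℕ} (Ω : ℕ → Type*) [∀ ν, MeasurableSpace (Ω ν)]
    (P : ∀ ν, Measure (Ω ν)) [∀ ν, IsProbabilityMeasure (P ν)]
    (N : ℕ → ℕ) (y : ∀ ν, Fin (N ν) → Ω ν → Cell r c) (incl : ∀ ν, Fin (N ν) → Ω ν → ℝ)
    (A : ∀ ν, Ω ν → Finset (Fin (N ν)))
    (hsample : ∀ ν, IsPoissonSample (P ν) (y ν) (incl ν) (A ν))
    (p : Cell r c → ℝ) (hp_pos : ∀ a, 0 < p a)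
    (hp : ∀ a, Tendsto (fun ν => (∑ i, (P ν).real {ω | y ν i ω = a}) / N ν) atTop (𝓝 (p a)))
    (hn : Tendsto (fun ν => expectedSize (P ν) (incl ν)) atTop atTop)
    (hnN : Tendsto (fun ν => expectedSize (P ν) (incl ν) / N ν) atTop (𝓝 0))
    (C₁ C₂ : ℝ) (hC₁ : 0 < C₁) (hC₂ : 0 < C₂)
    (hincl : ∀ ν i, ∀ᵐ ω ∂(P ν),
      C₁ ≤ N ν / expectedSize (P ν) (incl ν) * incl ν i ω ∧
        N ν / expectedSize (P ν) (incl ν) * incl ν i ω ≤ C₂)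
    (Sp : Matrix (FreeCell r c) (FreeCell r c) ℝ)
    (hSp : ∀ a b : FreeCell r c,
      Tendsto (fun ν => expectedSize (P ν) (incl ν) *
        cov[weightedScore p (y ν) (incl ν) (A ν) a.1,
          weightedScore p (y ν) (incl ν) (A ν) b.1; P ν]) atTop (𝓝 (Sp a b))) :
    ∃ δ : Fin (r * c) → ℝ, Monotone δ ∧
      (designEffect p Sp).charpoly = ∏ l, (Polynomial.X - Polynomial.C (δ l)) ∧
      TendstoConditionally P
        (fun ν ω => bootStatLaw pearsonStat (A ν ω) (fun i => incl ν i ω) (fun i => y ν i ω))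
        (weightedChiSq δ) ∧
      (Independence p →
        TendstoConditionally P
          (fun ν ω => bootStatLaw lrStat (A ν ω) (fun i => incl ν i ω) (fun i => y ν i ω))
          (weightedChiSq δ)) := by
  have h : PoissonDesigns P N y incl A C₁ :=
    ⟨hsample, hn, hnN, hC₁, fun ν i => (hincl ν i).mono fun _ hω => hω.1⟩
  have hupper := fun ν i => (hincl ν i).mono fun _ hω => hω.2
  obtain ⟨δ, hmono, hchar, hlaw⟩ := exists_spectrum_designEffect hp_pos (h.sum_limit_eq_one hp)
    (h.posSemidef_limit hSp)
  refine ⟨δ, hmono, hchar, ?_, fun hind => ?_⟩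
  · rw [← hlaw]
    exact h.tendstoConditionally hupper hp hSp measurable_pearsonStat
      fun hn' hq hu => tendsto_pearsonStat hp_pos hn' hq hu
  · rw [← hlaw]
    exact h.tendstoConditionally hupper hp hSp measurable_lrStat
      fun hn' hq hu => tendsto_lrStat hp_pos hind hn' hq hu
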